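/- For a positive integer $n \ge 4$ let $W_n = K_1 \vee C_{n-1}$ be the wheel of order $n$ (a cycle on $n-1$ vertices together with one further vertex adjacent to all of them), so that $W_5$ has $5$ vertices. For graphs $G$ and $H$ and an integer $k \ge 1$, let $gr_k(G : H)$ be the minimum integer $m$ such that every colouring of the edges of the complete graph $K_m$ with colours from $\{1,\dots,k\}$ (not all colours need be used) contains either a rainbow copy of $G$ (a copy whose edges have pairwise distinct colours) or a monochromatic copy of $H$ (a copy all of whose edges have the same colour). Copies are subgraphs, not necessarily induced. **Theorem.** For every integer $k \ge 1$, $$ gr_k(K_3 : W_5) = \begin{cases} 5 & \text{if } k = 1,\\ 14\cdot 5^{\frac{k-2}{2}} + 1 & \text{if } k \text{ is even},\\ 28\cdot 5^{\frac{k-3}{2}} + 1 & \text{if } k \ge 3 \text{ is odd}. \end{cases} $$ -/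

import Mathlib

/-- The wheel `W_n = K_1 ∨ C_{n-1}` of order `n` (meant for `n ≥ 4`): the join of a hub
`Sum.inl ()` with a cycle on the `n - 1` vertices `Sum.inr i`, `i : Fin (n - 1)`. -/
def wheelGraph (n : ℕ) : SimpleGraph (Unit ⊕ Fin (n - 1)) :=
  ((⊥ : SimpleGraph Unit).sum (SimpleGraph.cycleGraph (n - 1))) ⊔
    completeBipartiteGraph Unit (Fin (n - 1))

/-- The edge-colouring `C` of the complete graph on `V` contains a rainbow copy of `G`: a
(not necessarily induced) copy of `G` no two edges of which have the same colour. -/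
def HasRainbowCopy {V K W : Type*} (C : SimpleGraph.TopEdgeLabeling V K)
    (G : SimpleGraph W) : Prop :=
  ∃ f : G.Copy (⊤ : SimpleGraph V), Function.Injective fun e : G.edgeSet => C (f.mapEdgeSet e)

/-- The edge-colouring `C` of the complete graph on `V` contains a monochromatic copy of `H`:
for some colour `c`, the graph formed by the edges of colour `c` contains a
(not necessarily induced) copy of `H`. -/
def HasMonochromaticCopy {V K W : Type*} (C : SimpleGraph.TopEdgeLabeling V K)
    (H : SimpleGraph W) : Prop :=
  ∃ c : K, SimpleGraph.IsContained H (C.labelGraph c)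

/-- `m` is the `k`-coloured Gallai–Ramsey number `gr_k(G : H)`: the minimum integer `m` such that
every edge-colouring of the complete graph on `m` vertices with colours from a set of `k` colours
(not all of which have to be used) contains a rainbow copy of `G` or a monochromatic copy
of `H`. In particular such integers exist. -/
def IsGallaiRamseyNumber {W W' : Type*} (k : ℕ) (G : SimpleGraph W) (H : SimpleGraph W')
    (m : ℕ) : Prop :=
  IsLeast {m : ℕ | ∀ C : SimpleGraph.TopEdgeLabeling (Fin m) (Fin k),
    HasRainbowCopy C G ∨ HasMonochromaticCopy C H} m

/-!
For `k ≥ 2` the lower bound starts from a two-colouring of the complete graph on `ℤ/14` without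
monochromatic `W₅`; for `k = 1` four vertices are too few for a wheel. Replacing every vertex
of a pentagon-coloured `K₅` by a copy of a given colouring adds two colours, whose classes are
triangle-free and hence contain no wheel, and multiplies the order by five; joining two copies by
one new colour doubles the order (`IsGood.blowUp`).

For the upper bound, a statement about vertex subsets `S` of a colouring without rainbow triangles
and monochromatic `W₅` is proved by induction on `|S|` (`IsGood.hasWheelBound`). It records for
every colour how the vertices outside `S` restrict it inside `S`. If one outside vertex is joined
to all of `S` in colour `r`, then `S` contains no four-cycle of colour `r`. If there are two, the
edges of colour `r` inside `S` form a matching. The bound `wheelBound m n` depends on the number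
`m` of unrestricted colours and the number `n` of colours restricted by one outside vertex; colours
that form matchings do not count.

If a cut of `S` is monochromatic, then each side sees the other as outside vertices, and induction
applies to both sides (`hasWheelBound_of_split`). Otherwise Gallai's theorem
(`IsGallai.exists_partition`) partitions `S` such that only two colours occur between the parts,
and each of them occurs at every part. If all parts are singletons, then `S` is two-coloured and
has at most `14` elements, or at most `8` if one of the two colours is restricted, because
the Ramsey numbers of `W₅` against `W₅` and against `C₄` are `15` and `9`. Otherwise take a part with at least two
elements. In either colour its neighbours form a set in which that colour is a matching and which
consists of few parts (`IsPrimePartition.card_nbrs_le`), so that three applications of the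
induction hypothesis bound `|S|`.

The two small Ramsey numbers come from a depth-first search, certified by `refute_sound` and
evaluated by the kernel. It shows that a vertex has at most eight neighbours in each colour, and
that eight neighbours in one colour leave room for only three in the other. Hence on fifteen
vertices every colour class would be seven-regular, contrary to parity.
-/

/-! ### Exhaustive search for two-colourings without monochromatic wheels -/

/-- `G` contains no copy of the wheel `W₅`: no hub `v` is adjacent to all vertices of a four-cycle
`p q s u`. -/
def WheelFree {V : Type*} (G : SimpleGraph V) : Prop :=
  ∀ v p q s u, p ≠ s → q ≠ u → G.Adj v p → G.Adj v q → G.Adj v s → G.Adj v u →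
    G.Adj p q → G.Adj q s → G.Adj s u → G.Adj u p → False

noncomputable section Search

/-- The binary expansion of `m` has at least two ones: clearing the lowest one leaves something. -/
def hasTwoBits (m : ℕ) : Bool := Nat.ble 1 (Nat.land m (Nat.sub m 1))

/-- Some index `i` that is set in the mask has `p L[i]`. The recursor is used directly, here and
below, because the kernel evaluates it much faster than a structural recursion. -/
def anyRow (p : ℕ → Bool) (L : List ℕ) : ℕ → Bool :=
  List.rec (fun _ => false)
    (fun a _ ih m => (Nat.beq (Nat.land m 1) 1 && p a) || ih (Nat.shiftRight m 1)) L

/-- Two opposite rim vertices, set in the mask, have two common neighbours inside `N`. -/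
def hubCheck (N : ℕ) (L : List ℕ) : ℕ → Bool :=
  List.rec (fun _ => false)
    (fun a L ih m => (Nat.beq (Nat.land m 1) 1 &&
        anyRow (fun a' => hasTwoBits (Nat.land a (Nat.land a' N))) L (Nat.shiftRight m 1)) ||
      ih (Nat.shiftRight m 1)) L

/-- A new vertex with neighbourhood `N` is a rim vertex of a wheel in the graph with rows `L`. -/
def rimCheck (N : ℕ) (L : List ℕ) : Bool :=
  anyRow (fun a => anyRow (fun a' => hasTwoBits (Nat.land a (Nat.land a' N))) L a) L N

/-- A new vertex with neighbourhood `N` lies in a wheel. -/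
def newWheel (L : List ℕ) (N : ℕ) : Bool := rimCheck N L || hubCheck N L N

/-- Add the bit `p` to the rows whose index is set in the mask. -/
def addBit (p : ℕ) (L : List ℕ) : ℕ → List ℕ :=
  List.rec (fun _ => [])
    (fun a _ ih m => (bif Nat.beq (Nat.land m 1) 1 then Nat.lor a p else a) ::
      ih (Nat.shiftRight m 1)) L

/-- The adjacency rows after a vertex of index `n` with neighbourhood `N` has been added. -/
def addRow (n : ℕ) (L : List ℕ) (N : ℕ) : List ℕ := addBit (Nat.pow 2 n) L N ++ [N]

/-- A new vertex that is joined in the first colour to the vertices in `N`, and in the second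
colour to the other ones among the first `n` vertices, lies in a monochromatic wheel. -/
def clash (n : ℕ) (BL RL : List ℕ) (N : ℕ) : Bool :=
  newWheel BL N || newWheel RL (Nat.sub (Nat.pow 2 n) (Nat.add N 1))

/-- All extensions by `d` further bits of the partial neighbourhoods in `pool`, which decide the
first `i` bits, that do not produce a wheel. -/
def extendRows (BL RL : List ℕ) : ℕ → ℕ → List ℕ → List ℕ
  | 0, _, pool => pool
  | d + 1, i, pool => extendRows BL RL d (i + 1)
      ((pool ++ pool.map fun N => Nat.lor N (Nat.pow 2 i)).filter fun N => !clash (i + 1) BL RL N)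

/-- Depth-first search; the value `true` certifies that the two-coloured complete graph on `n`
vertices with adjacency rows `BL` and `RL` cannot be extended as prescribed without a
monochromatic wheel. Still to be added are `k` vertices whose neighbourhoods among the first `b`
vertices belong to `pool`, and then, for each `(u, r, k')` in the list of phases, `k'` vertices
whose neighbourhood among the first `u` vertices is `r`. The vertices of one phase are
interchangeable, so they are added in the order in which `pool` lists their neighbourhoods. -/
def refute : ℕ → ℕ → List ℕ → List ℕ → ℕ → ℕ → List ℕ → List (ℕ × ℕ × ℕ) → Bool
  | 0, _, _, _, _, _, _, _ => false
  | _ + 1, _, _, _, _, 0, _, [] => false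
  | f + 1, n, BL, RL, _, 0, _, (u, r, k) :: ph =>
    refute f n BL RL n k (extendRows BL RL (n - u) u [r]) ph
  | _ + 1, _, _, _, _, _ + 1, [], _ => true
  | f + 1, n, BL, RL, b, k + 1, N :: pool, ph =>
    refute f n BL RL b (k + 1) pool ph &&
      (extendRows BL RL (n - b) b [N]).all fun N' =>
        refute f (n + 1) (addRow n BL N') (addRow n RL (Nat.sub (Nat.pow 2 n) (Nat.add N' 1)))
          b k (N :: pool) ph

end Search

lemma exists_two_bits {m : ℕ} (h : hasTwoBits m = true) :
    ∃ i j, i ≠ j ∧ m.testBit i = true ∧ m.testBit j = true := by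
  have h1 : m &&& (m - 1) ≠ 0 := by
    have : 1 ≤ m &&& (m - 1) := Nat.le_of_ble_eq_true h
    omega
  obtain ⟨i, hi⟩ := Nat.exists_testBit_of_ne_zero h1
  rw [Nat.testBit_and, Bool.and_eq_true] at hi
  have hne : m ≠ 2 ^ i := by
    rintro rfl
    have := hi.2
    rw [Nat.testBit_two_pow_sub_one] at this
    simp at this
  obtain ⟨j, hj⟩ := Nat.exists_testBit_ne_of_ne hne
  have hij : i ≠ j := by
    rintro rfl
    simp [hi.1, Nat.testBit_two_pow_self] at hj
  rw [Nat.testBit_two_pow_of_ne hij] at hj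
  exact ⟨i, j, hij, hi.1, by simpa using hj⟩

lemma beq_land_one (m : ℕ) : Nat.beq (Nat.land m 1) 1 = m.testBit 0 := by
  change Nat.beq (m &&& 1) 1 = _
  rw [Nat.testBit_zero, Nat.and_one_is_mod, Bool.eq_iff_iff]
  simp

lemma testBit_shiftRight_one (m i : ℕ) : (Nat.shiftRight m 1).testBit i = m.testBit (i + 1) := by
  change (m >>> 1).testBit i = _
  rw [Nat.testBit_shiftRight, Nat.add_comm]

lemma testBit_land' (a b i : ℕ) : (Nat.land a b).testBit i = (a.testBit i && b.testBit i) :=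
  Nat.testBit_and a b i

lemma anyRow_sound {p : ℕ → Bool} {L : List ℕ} {m : ℕ} (h : anyRow p L m = true) :
    ∃ i, ∃ hi : i < L.length, m.testBit i = true ∧ p L[i] = true := by
  induction L generalizing m with
  | nil => exact absurd h (by simp [anyRow])
  | cons a L ih =>
    have h' : ((Nat.beq (Nat.land m 1) 1 && p a) || anyRow p L (Nat.shiftRight m 1)) = true := h
    rw [beq_land_one, Bool.or_eq_true, Bool.and_eq_true] at h'
    rcases h' with h' | h'
    · exact ⟨0, by simp, h'.1, h'.2⟩
    · obtain ⟨i, hi, h1, h2⟩ := ih h'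
      exact ⟨i + 1, by simpa using hi, by rwa [testBit_shiftRight_one] at h1, by simpa using h2⟩

lemma hubCheck_sound {N : ℕ} {L : List ℕ} {m : ℕ} (h : hubCheck N L m = true) :
    ∃ i j, ∃ hi : i < L.length, ∃ hj : j < L.length, i ≠ j ∧ m.testBit i = true ∧
      m.testBit j = true ∧ hasTwoBits (Nat.land L[i] (Nat.land L[j] N)) = true := by
  induction L generalizing m with
  | nil => exact absurd h (by simp [hubCheck])
  | cons a L ih =>
    have h' : ((Nat.beq (Nat.land m 1) 1 &&
        anyRow (fun a' => hasTwoBits (Nat.land a (Nat.land a' N))) L (Nat.shiftRight m 1)) ||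
      hubCheck N L (Nat.shiftRight m 1)) = true := h
    rw [beq_land_one, Bool.or_eq_true, Bool.and_eq_true] at h'
    rcases h' with h' | h'
    · obtain ⟨j, hj, h1, h2⟩ := anyRow_sound h'.2
      rw [testBit_shiftRight_one] at h1
      exact ⟨0, j + 1, by simp, by simpa using hj, by simp, h'.1, h1, by simpa using h2⟩
    · obtain ⟨i, j, hi, hj, hne, h1, h2, h3⟩ := ih h'
      rw [testBit_shiftRight_one] at h1 h2
      exact ⟨i + 1, j + 1, by simpa using hi, by simpa using hj, by simpa using hne, h1, h2,
        by simpa using h3⟩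

lemma addBit_length (p : ℕ) (L : List ℕ) (m : ℕ) : (addBit p L m).length = L.length := by
  induction L generalizing m with
  | nil => rfl
  | cons a L ih =>
    change (_ :: addBit p L (Nat.shiftRight m 1)).length = _
    simp [ih]

lemma addBit_getElem (p : ℕ) (L : List ℕ) (m i : ℕ) (hi : i < L.length) :
    (addBit p L m)[i]'(by rwa [addBit_length]) = if m.testBit i then L[i] ||| p else L[i] := by
  induction L generalizing m i with
  | nil => simp at hi
  | cons a L ih =>
    cases i with
    | zero =>
      change (bif Nat.beq (Nat.land m 1) 1 then Nat.lor a p else a) = _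
      rw [beq_land_one]
      cases m.testBit 0 <;> rfl
    | succ i =>
      have := ih (Nat.shiftRight m 1) i (by simpa using hi)
      rw [testBit_shiftRight_one] at this
      exact this

section Sound

variable {V : Type*} {G : SimpleGraph V} {x : ℕ → V} {n : ℕ}

/-- The bits of `N` are the neighbours of `y` among the first `n` listed vertices. -/
def IsRow (G : SimpleGraph V) (x : ℕ → V) (n : ℕ) (y : V) (N : ℕ) : Prop :=
  ∀ j, N.testBit j = true ↔ j < n ∧ G.Adj y (x j)

/-- `L` is the list of adjacency rows of the first `n` listed vertices. -/
def IsRows (G : SimpleGraph V) (x : ℕ → V) (n : ℕ) (L : List ℕ) : Prop :=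
  L.length = n ∧ ∀ i (hi : i < L.length), IsRow G x n (x i) L[i]

lemma newWheel_sound (hG : WheelFree G) {L : List ℕ} (hL : IsRows G x n L)
    (hx : ∀ i < n, ∀ j < n, x i = x j → i = j) {y : V} (hy : ∀ i < n, x i ≠ y) {N : ℕ}
    (hN : ∀ j, N.testBit j = true → j < n ∧ G.Adj y (x j)) : newWheel L N = false := by
  obtain ⟨rfl, hL⟩ := hL
  rw [Bool.eq_false_iff]
  intro h
  rw [newWheel, Bool.or_eq_true] at h
  rcases h with h | h
  · obtain ⟨i, hi, hNi, h⟩ := anyRow_sound h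
    obtain ⟨k, hk, hik, h⟩ := anyRow_sound h
    obtain ⟨a, b, hab, ha, hb⟩ := exists_two_bits h
    simp only [testBit_land', Bool.and_eq_true] at ha hb
    have hik' := ((hL i hi k).1 hik).2
    have hai := ((hL i hi a).1 ha.1)
    have hbi := ((hL i hi b).1 hb.1)
    have hak := ((hL k hk a).1 ha.2.1).2
    have hbk := ((hL k hk b).1 hb.2.1).2
    exact hG (x i) y (x a) (x k) (x b) (hy k hk).symm (fun e => hab (hx a hai.1 b hbi.1 e))
      (hN i hNi).2.symm hai.2 hik' hbi.2 (hN a ha.2.2).2 hak.symm hbk (hN b hb.2.2).2.symm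
  · obtain ⟨i, k, hi, hk, hik, hNi, hNk, h⟩ := hubCheck_sound h
    obtain ⟨a, b, hab, ha, hb⟩ := exists_two_bits h
    simp only [testBit_land', Bool.and_eq_true] at ha hb
    have hai := ((hL i hi a).1 ha.1)
    have hbi := ((hL i hi b).1 hb.1)
    have hak := ((hL k hk a).1 ha.2.1).2
    have hbk := ((hL k hk b).1 hb.2.1).2
    exact hG y (x i) (x a) (x k) (x b) (fun e => hik (hx i hi k hk e))
      (fun e => hab (hx a hai.1 b hbi.1 e)) (hN i hNi).2 (hN a ha.2.2).2 (hN k hNk).2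
      (hN b hb.2.2).2 hai.2 hak.symm hbk hbi.2.symm

lemma IsRow.compl {y : V} {N : ℕ} (h : IsRow G x n y N) (hy : ∀ i < n, x i ≠ y) :
    IsRow Gᶜ x n y (Nat.sub (Nat.pow 2 n) (Nat.add N 1)) := by
  intro j
  change (2 ^ n - (N + 1)).testBit j = true ↔ _
  have hlt : N < 2 ^ n := Nat.lt_pow_two_of_testBit _ fun i hi => by
    rw [Bool.eq_false_iff]
    exact fun h' => absurd ((h i).1 h').1 (by omega)
  rw [Nat.testBit_two_pow_sub_succ hlt, SimpleGraph.compl_adj]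
  have := h j
  by_cases hj : j < n
  · have hne : y ≠ x j := (hy j hj).symm
    simp only [hj, true_and] at this
    simp [hj, hne, ← this]
  · simp [hj]

lemma clash_sound (hG : WheelFree G) (hG' : WheelFree Gᶜ) {BL RL : List ℕ}
    (hB : IsRows G x n BL) (hR : IsRows Gᶜ x n RL) (hx : ∀ i < n, ∀ j < n, x i = x j → i = j)
    {y : V} (hy : ∀ i < n, x i ≠ y) {m N : ℕ} (hm : m ≤ n) (hN : IsRow G x m y N) :
    clash m BL RL N = false := by
  rw [clash, newWheel_sound hG hB hx hy fun j hj => ⟨((hN j).1 hj).1.trans_le hm, ((hN j).1 hj).2⟩,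
    newWheel_sound hG' hR hx hy fun j hj => ?_]
  · rfl
  · have := ((hN.compl fun i hi => hy i (hi.trans_le hm)) j).1 hj
    exact ⟨this.1.trans_le hm, this.2⟩

lemma extendRows_sound (hG : WheelFree G) (hG' : WheelFree Gᶜ) {BL RL : List ℕ}
    (hB : IsRows G x n BL) (hR : IsRows Gᶜ x n RL) (hx : ∀ i < n, ∀ j < n, x i = x j → i = j)
    {y : V} (hy : ∀ i < n, x i ≠ y) {d i : ℕ} (hd : i + d ≤ n) {pool : List ℕ}
    (hp : ∃ N ∈ pool, IsRow G x i y N) :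
    ∃ N ∈ extendRows BL RL d i pool, IsRow G x (i + d) y N := by
  classical
  induction d generalizing i pool with
  | zero => exact hp
  | succ d ih =>
    rw [extendRows, show i + (d + 1) = i + 1 + d by omega]
    refine ih (by omega) ?_
    obtain ⟨N, hN, hrow⟩ := hp
    obtain ⟨N', hN', hrow'⟩ : ∃ N' ∈ pool ++ pool.map fun N => Nat.lor N (Nat.pow 2 i),
        IsRow G x (i + 1) y N' := by
      by_cases hadj : G.Adj y (x i)
      · refine ⟨N ||| 2 ^ i, List.mem_append_right _ (List.mem_map_of_mem hN), fun j => ?_⟩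
        rw [Nat.testBit_or, Bool.or_eq_true, hrow j, Nat.testBit_two_pow, decide_eq_true_iff]
        constructor
        · rintro (⟨h1, h2⟩ | rfl)
          · exact ⟨by omega, h2⟩
          · exact ⟨by omega, hadj⟩
        · rintro ⟨h1, h2⟩
          rcases Nat.lt_succ_iff_lt_or_eq.1 h1 with h | h
          · exact .inl ⟨h, h2⟩
          · exact .inr h.symm
      · refine ⟨N, List.mem_append_left _ hN, fun j => (hrow j).trans ?_⟩
        constructor
        · rintro ⟨h1, h2⟩
          exact ⟨by omega, h2⟩
        · rintro ⟨h1, h2⟩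
          rcases Nat.lt_succ_iff_lt_or_eq.1 h1 with h | rfl
          · exact ⟨h, h2⟩
          · exact absurd h2 hadj
    refine ⟨N', List.mem_filter.2 ⟨hN', ?_⟩, hrow'⟩
    rw [clash_sound hG hG' hB hR hx hy (by omega) hrow']
    rfl

lemma IsRow.update {m : ℕ} (hm : m ≤ n) {y z : V} {N : ℕ} (h : IsRow G x m z N) :
    IsRow G (Function.update x n y) m z N := by
  intro j
  rw [h j]
  refine and_congr_right fun hj => ?_
  rw [Function.update_of_ne (by omega)]

lemma IsRows.addRow {L : List ℕ} (hL : IsRows G x n L) {y : V} {N : ℕ} (hN : IsRow G x n y N) :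
    IsRows G (Function.update x n y) (n + 1) (addRow n L N) := by
  obtain ⟨rfl, hL⟩ := hL
  refine ⟨by simp [_root_.addRow, addBit_length], fun i hi j => ?_⟩
  have hi' : i < L.length + 1 := by simpa [_root_.addRow, addBit_length] using hi
  rcases Nat.lt_succ_iff_lt_or_eq.1 hi' with h | h
  · have hget : (_root_.addRow L.length L N)[i] =
        if N.testBit i then L[i] ||| 2 ^ L.length else L[i] := by
      rw [← addBit_getElem _ _ _ _ h]
      exact List.getElem_append_left (by rwa [addBit_length])
    rw [hget, Function.update_of_ne h.ne]
    by_cases hj : j < L.length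
    · have hne : L.length ≠ j := by omega
      rw [Function.update_of_ne (by omega)]
      have := hL i h j
      split_ifs <;> simp [Nat.testBit_or, Nat.testBit_two_pow_of_ne hne, this, hj, hj.trans]
    · have hf : L[i].testBit j = false := by
        rw [Bool.eq_false_iff]
        exact fun h' => hj ((hL i h j).1 h').1
      by_cases hj' : j = L.length
      · subst hj'
        rw [Function.update_self, G.adj_comm]
        have := hN i
        simp only [h, true_and] at this
        by_cases hb : N.testBit i = true
        · simp [hb, Nat.testBit_or, this.1 hb]
        · simp [hb, hf, show ¬ G.Adj y (x i) from fun h => hb (this.2 h)]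
      · have hne : L.length ≠ j := fun e => hj' e.symm
        have : ¬ j < L.length + 1 := by omega
        split_ifs <;> simp [Nat.testBit_or, Nat.testBit_two_pow_of_ne hne, hf, this]
  · subst h
    have hget : (_root_.addRow L.length L N)[L.length] = N := by
      simp only [_root_.addRow]
      rw [List.getElem_append_right (by simp [addBit_length])]
      simp [addBit_length]
    rw [hget, Function.update_self, hN j]
    by_cases hj : j < L.length
    · rw [Function.update_of_ne (by omega)]
      simp [hj, hj.trans]
    · by_cases hj' : j = L.length
      · subst hj'
        simp
      · have : ¬ j < L.length + 1 := by omega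
        simp [hj, this]

/-- Soundness of the search: `U` is the set of vertices still to be added in the current phase,
and `Us` lists the sets of vertices for the later phases. -/
theorem refute_sound [DecidableEq V] (hG : WheelFree G) (hG' : WheelFree Gᶜ) (f : ℕ) :
    ∀ (n : ℕ) (BL RL : List ℕ) (b k : ℕ) (pool : List ℕ) (ph : List (ℕ × ℕ × ℕ)) (x : ℕ → V)
      (U : Finset V) (Us : List (Finset V)), refute f n BL RL b k pool ph = true →
      IsRows G x n BL → IsRows Gᶜ x n RL → (∀ i < n, ∀ j < n, x i = x j → i = j) → b ≤ n →
      U.card = k → (∀ y ∈ U, ∃ N ∈ pool, IsRow G x b y N) →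
      List.Forall₂ (fun p W => W.card = p.2.2 ∧ p.1 ≤ n ∧ ∀ y ∈ W, IsRow G x p.1 y p.2.1) ph Us →
      (∀ W ∈ U :: Us, ∀ i < n, x i ∉ W) → (U :: Us).Pairwise Disjoint → False := by
  induction f with
  | zero => intro n BL RL b k pool ph x U Us h; simp [refute] at h
  | succ f ih =>
    intro n BL RL b k pool ph x U Us h hB hR hx hb hU hpool hph hfresh hdisj
    match k, ph, pool with
    | 0, [], _ => simp [refute] at h
    | 0, (u, r, k) :: ph, _ =>
      cases hph with
      | @cons _ W _ Us hW hph =>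
        rw [refute] at h
        refine ih _ _ _ _ _ _ _ x W Us h hB hR hx le_rfl hW.1 (fun y hy => ?_) hph
          (fun W' hW' => hfresh W' (List.mem_cons_of_mem _ hW')) hdisj.of_cons
        have := extendRows_sound hG hG' hB hR hx (d := n - u) (i := u) (y := y)
          (fun i hi e => hfresh W (by simp) i hi (e ▸ hy)) (by have := hW.2.1; simp at this; omega)
          ⟨r, List.mem_singleton_self r, hW.2.2 y hy⟩
        rwa [Nat.add_sub_cancel' hW.2.1] at this
    | k + 1, _, [] =>
      obtain ⟨y, hy⟩ : U.Nonempty := by rw [← Finset.card_pos]; omega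
      obtain ⟨N, hN, -⟩ := hpool y hy
      simp at hN
    | k + 1, ph, N :: pool =>
      rw [refute, Bool.and_eq_true, List.all_eq_true] at h
      by_cases hex : ∃ y ∈ U, IsRow G x b y N
      · obtain ⟨y, hy, hrow⟩ := hex
        have hyx : ∀ i < n, x i ≠ y := fun i hi e => hfresh U (by simp) i hi (e ▸ hy)
        obtain ⟨N', hN', hrow'⟩ := extendRows_sound hG hG' hB hR hx (d := n - b) (i := b) (y := y)
          hyx (by omega) ⟨N, List.mem_singleton_self N, hrow⟩
        rw [Nat.add_sub_cancel' hb] at hrow'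
        rw [List.pairwise_cons] at hdisj
        refine ih _ _ _ _ _ _ _ (Function.update x n y) (U.erase y) Us (h.2 N' hN')
          (hB.addRow hrow') (hR.addRow (hrow'.compl hyx)) ?_ (by omega)
          (by rw [Finset.card_erase_of_mem hy, hU]; rfl) ?_ ?_ ?_ ?_
        · intro i hi j hj e
          by_cases hin : i = n <;> by_cases hjn : j = n
          · omega
          · subst hin
            rw [Function.update_self, Function.update_of_ne hjn] at e
            exact absurd e.symm (hyx j (by omega))
          · subst hjn
            rw [Function.update_self, Function.update_of_ne hin] at e
            exact absurd e (hyx i (by omega))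
          · rw [Function.update_of_ne hin, Function.update_of_ne hjn] at e
            exact hx i (by omega) j (by omega) e
        · intro z hz
          obtain ⟨M, hM, hMz⟩ := hpool z (Finset.mem_of_mem_erase hz)
          exact ⟨M, hM, hMz.update hb⟩
        · refine hph.imp fun p W hW => ⟨hW.1, hW.2.1.trans (Nat.le_succ n), fun z hz => ?_⟩
          exact (hW.2.2 z hz).update hW.2.1
        · intro W hW i hi
          by_cases hin : i = n
          · subst hin
            rw [Function.update_self]
            rcases List.mem_cons.1 hW with rfl | hW
            · exact Finset.notMem_erase y U
            · exact fun h' => Finset.disjoint_left.1 (hdisj.1 W hW) hy h'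
          · rw [Function.update_of_ne hin]
            rcases List.mem_cons.1 hW with rfl | hW
            · exact fun h' => hfresh U (by simp) i (by omega) (Finset.mem_of_mem_erase h')
            · exact hfresh W (List.mem_cons_of_mem _ hW) i (by omega)
        · rw [List.pairwise_cons]
          exact ⟨fun W hW => (hdisj.1 W hW).mono_left (Finset.erase_subset y U), hdisj.2⟩
      · refine ih _ _ _ _ _ _ _ x U Us h.1 hB hR hx hb hU (fun y hy => ?_) hph hfresh hdisj
        obtain ⟨M, hM, hMy⟩ := hpool y hy
        rcases List.mem_cons.1 hM with rfl | hM
        · exact absurd ⟨y, hy, hMy⟩ hex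
        · exact ⟨M, hM, hMy⟩

end Sound

section TwoColour

variable {V : Type*} {G : SimpleGraph V}

/-- A certified search applied to a vertex `w`, a neighbour `v` of it, common neighbours `P` of
both, vertices `Q` adjacent to `w` but not to `v`, and non-neighbours `B` of `w`. -/
lemma not_card_of_refute [DecidableEq V] (hG : WheelFree G) (hG' : WheelFree Gᶜ) {p q k : ℕ}
    (h : refute 100 2 [2, 1] [0, 0] 2 0 [] [(2, 3, p), (2, 1, q), (1, 0, k)] = true) {w v : V}
    (hwv : G.Adj w v) {P Q B : Finset V} (hP : ∀ y ∈ P, G.Adj w y ∧ G.Adj v y)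
    (hQ : ∀ y ∈ Q, G.Adj w y ∧ y ≠ v ∧ ¬ G.Adj v y) (hB : ∀ y ∈ B, y ≠ w ∧ ¬ G.Adj w y) :
    ¬ (p ≤ P.card ∧ q ≤ Q.card ∧ k ≤ B.card) := by
  rintro ⟨hp, hq, hk⟩
  obtain ⟨P, hP', rfl⟩ := Finset.exists_subset_card_eq hp
  obtain ⟨Q, hQ', rfl⟩ := Finset.exists_subset_card_eq hq
  obtain ⟨B, hB', rfl⟩ := Finset.exists_subset_card_eq hk
  replace hP := fun y hy => hP y (hP' hy)
  replace hQ := fun y hy => hQ y (hQ' hy)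
  replace hB := fun y hy => hB y (hB' hy)
  have hne := hwv.ne
  set x : ℕ → V := fun i => if i = 0 then w else v with hx
  have two : ∀ {N j : ℕ}, N < 4 → N.testBit j = true → j < 2 := fun {N j} hN h => by
    by_contra hj
    have := Nat.testBit_lt_two_pow (x := N) (i := j)
      (hN.trans_le (Nat.pow_le_pow_right (i := 2) (j := j) two_pos (by omega)))
    simp [h] at this
  have row2 : ∀ (H : SimpleGraph V) (y : V) (N : ℕ), N < 4 →
      (N.testBit 0 = true ↔ H.Adj y w) → (N.testBit 1 = true ↔ H.Adj y v) →
      IsRow H x 2 y N := by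
    intro H y N hN h0 h1 j
    constructor
    · intro h
      have hj := two hN h
      interval_cases j
      · exact ⟨hj, h0.1 h⟩
      · exact ⟨hj, h1.1 h⟩
    · rintro ⟨hj, h⟩
      interval_cases j
      · exact h0.2 h
      · exact h1.2 h
  have rows : ∀ (H : SimpleGraph V) (M N : ℕ), IsRow H x 2 w M → IsRow H x 2 v N →
      IsRows H x 2 [M, N] := by
    intro H M N h0 h1
    refine ⟨rfl, fun i hi => ?_⟩
    have hi' : i < 2 := hi
    interval_cases i
    · exact h0
    · exact h1
  refine refute_sound hG hG' 100 2 _ _ 2 0 [] _ x ∅ [P, Q, B] h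
    (rows _ _ _ (row2 _ _ _ (by simp) (by simp) (by simp [hwv, Nat.testBit]))
      (row2 _ _ _ (by simp) (by simp [hwv.symm]) (by simp [Nat.testBit])))
    (rows _ _ _ (row2 _ _ _ (by simp) (by simp) (by simp [hwv]))
      (row2 _ _ _ (by simp) (by simp [hwv.symm]) (by simp))) ?_ le_rfl rfl (by simp) ?_ ?_ ?_
  · intro i hi j hj e
    interval_cases i <;> interval_cases j <;> simp_all
  · refine .cons ⟨rfl, le_rfl, fun y hy => row2 _ _ _ (by simp) ?_ ?_⟩
      (.cons ⟨rfl, le_rfl, fun y hy => row2 _ _ _ (by simp) ?_ ?_⟩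
        (.cons ⟨rfl, by simp, fun y hy j => ?_⟩ .nil))
    · simp [(hP y hy).1.symm]
    · simp [(hP y hy).2.symm, Nat.testBit]
    · simp [(hQ y hy).1.symm]
    · simp [Nat.testBit, G.adj_comm y, (hQ y hy).2.2]
    · have := (hB y hy).2
      simp only [Nat.zero_testBit, Bool.false_eq_true, false_iff, not_and]
      intro hj
      obtain rfl : j = 0 := by simpa using hj
      rwa [G.adj_comm]
  · have hx' : ∀ i, x i = w ∨ x i = v := fun i => by simp only [hx]; split_ifs <;> simp
    simp only [List.mem_cons, List.not_mem_nil, or_false, forall_eq_or_imp, forall_eq]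
    refine ⟨fun i _ => Finset.notMem_empty _, fun i _ hi => ?_, fun i _ hi => ?_, fun i _ hi => ?_⟩
    · rcases hx' i with e | e <;> rw [e] at hi
      · exact (hP _ hi).1.ne rfl
      · exact (hP _ hi).2.ne rfl
    · rcases hx' i with e | e <;> rw [e] at hi
      · exact (hQ _ hi).1.ne rfl
      · exact (hQ _ hi).2.1 rfl
    · rcases hx' i with e | e <;> rw [e] at hi
      · exact (hB _ hi).1 rfl
      · exact (hB _ hi).2 hwv
  · simp only [List.pairwise_cons, List.mem_cons, List.not_mem_nil, or_false, forall_eq_or_imp,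
      forall_eq, Finset.disjoint_left]
    refine ⟨by simp, ⟨fun y h1 h2 => (hQ y h2).2.2 (hP y h1).2,
      fun y h1 h2 => (hB y h2).2 (hP y h1).1⟩, fun y h1 h2 => (hB y h2).2 (hQ y h1).1, by simp,
      List.Pairwise.nil⟩

/-- A vertex of a two-coloured complete graph without monochromatic `W₅` has at most eight
neighbours in each colour; that is, the Ramsey number of `C₄` and `W₅` is at most nine. -/
lemma card_nbrs_le_eight (hG : WheelFree G) (hG' : WheelFree Gᶜ) {w : V} {A : Finset V}
    (hA : ∀ a ∈ A, G.Adj w a) : A.card ≤ 8 := by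
  classical
  by_contra! hcard
  obtain ⟨v, hv⟩ : A.Nonempty := by rw [← Finset.card_pos]; omega
  have key := fun p q h => not_card_of_refute (p := p) (q := q) (k := 0) hG hG' h (hA v hv)
    (P := (A.erase v).filter (G.Adj v)) (Q := (A.erase v).filter (¬ G.Adj v ·)) (B := ∅)
    (fun y hy => by simp at hy; exact ⟨hA y hy.1.2, hy.2⟩)
    (fun y hy => by simp at hy; exact ⟨hA y hy.1.2, hy.1.1, hy.2⟩) (by simp)
  have hsum := Finset.card_filter_add_card_filter_not (s := A.erase v) (G.Adj v)
  rw [Finset.card_erase_of_mem hv] at hsum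
  have h5 := key 5 0 (by decide +kernel)
  have h4 := key 4 3 (by decide +kernel)
  have h3 := key 3 5 (by decide +kernel)
  have h2 := key 2 6 (by decide +kernel)
  have h1 := key 1 6 (by decide +kernel)
  have h0 := key 0 7 (by decide +kernel)
  omega

/-- If a vertex has eight neighbours in one colour, it has at most three in the other one: up to
isomorphism there is only one possibility for the colouring on those eight neighbours, and it
is too rigid to leave room for a fourth vertex outside. -/
lemma card_nonnbrs_le_three (hG : WheelFree G) (hG' : WheelFree Gᶜ) {w : V} {A B : Finset V}
    (hA : ∀ a ∈ A, G.Adj w a) (hB : ∀ b ∈ B, b ≠ w ∧ ¬ G.Adj w b) (hcard : A.card = 8) :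
    B.card ≤ 3 := by
  classical
  by_contra! hBcard
  obtain ⟨v, hv⟩ : A.Nonempty := by rw [← Finset.card_pos]; omega
  have key := fun p q k h => not_card_of_refute (p := p) (q := q) (k := k) hG hG' h (hA v hv)
    (P := (A.erase v).filter (G.Adj v)) (Q := (A.erase v).filter (¬ G.Adj v ·)) (B := B)
    (fun y hy => by simp at hy; exact ⟨hA y hy.1.2, hy.2⟩)
    (fun y hy => by simp at hy; exact ⟨hA y hy.1.2, hy.1.1, hy.2⟩) hB
  have hsum := Finset.card_filter_add_card_filter_not (s := A.erase v) (G.Adj v)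
  rw [Finset.card_erase_of_mem hv, hcard] at hsum
  have h5 := key 5 0 0 (by decide +kernel)
  have h4 := key 4 3 0 (by decide +kernel)
  have h3 := key 3 4 4 (by decide +kernel)
  have h2 := key 2 5 4 (by decide +kernel)
  have h1 := key 1 6 0 (by decide +kernel)
  have h0 := key 0 7 0 (by decide +kernel)
  omega

/-- The Ramsey number of `W₅` is at most fifteen. On fifteen vertices every colour class would be
seven-regular, which is impossible by parity. -/
theorem card_le_fourteen [Fintype V] (hG : WheelFree G) (hG' : WheelFree Gᶜ) :
    Fintype.card V ≤ 14 := by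
  classical
  by_contra! hcard
  obtain ⟨S, -, hS⟩ := Finset.exists_subset_card_eq (s := (Finset.univ : Finset V)) (n := 15)
    (by rw [Finset.card_univ]; omega)
  let A (w : V) : Finset V := (S.erase w).filter (G.Adj w)
  let B (w : V) : Finset V := (S.erase w).filter (¬ G.Adj w ·)
  have hA : ∀ w, ∀ a ∈ A w, G.Adj w a := fun w a ha => (Finset.mem_filter.1 ha).2
  have hB : ∀ w, ∀ b ∈ B w, b ≠ w ∧ ¬ G.Adj w b := fun w b hb =>
    ⟨Finset.ne_of_mem_erase (Finset.mem_filter.1 hb).1, (Finset.mem_filter.1 hb).2⟩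
  have hseven : ∀ w ∈ S, (A w).card = 7 := by
    intro w hw
    have hsum : (A w).card + (B w).card = 14 := by
      rw [Finset.card_filter_add_card_filter_not, Finset.card_erase_of_mem hw, hS]
    have hA' : ∀ a ∈ A w, a ≠ w ∧ ¬ Gᶜ.Adj w a := fun a ha => by
      simp [hA w a ha, (hA w a ha).ne']
    have hB' : ∀ b ∈ B w, Gᶜ.Adj w b := fun b hb => by
      rw [SimpleGraph.compl_adj]
      exact ⟨(hB w b hb).1.symm, (hB w b hb).2⟩
    have hG'' : WheelFree Gᶜᶜ := by rwa [compl_compl]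
    have h1 := card_nbrs_le_eight hG hG' (hA w)
    have h2 := card_nbrs_le_eight hG' hG'' hB'
    have h3 := card_nonnbrs_le_three hG hG' (hA w) (hB w)
    have h4 := card_nonnbrs_le_three hG' hG'' hB' hA'
    omega
  have hdeg : ∀ w : S, (G.induce (S : Set V)).degree w = 7 := by
    intro w
    rw [← hseven w w.2, SimpleGraph.degree, ← Finset.card_map (Function.Embedding.subtype _)]
    congr 1
    ext a
    simp only [Finset.mem_map, SimpleGraph.mem_neighborFinset, SimpleGraph.comap_adj, A,
      Finset.mem_filter, Finset.mem_erase, Function.Embedding.subtype_apply]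
    constructor
    · rintro ⟨b, hb, rfl⟩
      exact ⟨⟨hb.ne', b.2⟩, hb⟩
    · rintro ⟨⟨-, h2⟩, h3⟩
      exact ⟨⟨a, h2⟩, h3, rfl⟩
  have := (G.induce (S : Set V)).sum_degrees_eq_twice_card_edges
  simp only [hdeg, Finset.sum_const, Finset.card_univ, smul_eq_mul] at this
  simp only [SetLike.coe_sort_coe, Fintype.card_coe, hS] at this
  omega

end TwoColour

/-! ### Gallai partitions -/

section Gallai

variable {V K : Type*} {c : V → V → K}

/-- `c` is symmetric and every triangle has two edges of the same colour. Values of `c` on the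
diagonal are irrelevant. -/
structure IsGallai (c : V → V → K) : Prop where
  symm : ∀ x y, c x y = c y x
  triangle : ∀ x y z, x ≠ y → y ≠ z → x ≠ z → c x y = c y z ∨ c y z = c x z ∨ c x y = c x z

/-- Every edge cut of `S` contains an edge of colour `r`; that is, the edges of colour `r` form a
connected spanning graph on `S`. -/
def ColourConnects (c : V → V → K) (S : Finset V) (r : K) : Prop :=
  ∀ A ⊆ S, A.Nonempty → A ≠ S → ∃ x ∈ A, ∃ y ∈ S, y ∉ A ∧ c x y = r

/-- The graph formed by the edges of colour `r` inside `S`. -/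
def colourGraph (h : ∀ x y, c x y = c y x) (S : Finset V) (r : K) : SimpleGraph V where
  Adj x y := x ∈ S ∧ y ∈ S ∧ x ≠ y ∧ c x y = r
  symm := ⟨fun x y ⟨h1, h2, h3, h4⟩ => ⟨h2, h1, h3.symm, h y x ▸ h4⟩⟩
  loopless := ⟨fun _ h => h.2.2.1 rfl⟩

variable {S : Finset V} {r : K}

lemma mem_of_reachable {h : ∀ x y, c x y = c y x} {x y : V} (hx : x ∈ S)
    (hxy : (colourGraph h S r).Reachable x y) : y ∈ S := by
  rw [SimpleGraph.reachable_iff_reflTransGen] at hxy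
  induction hxy with
  | refl => exact hx
  | tail _ hbc _ => exact hbc.2.1

/-- A vertex sends a single colour to every component of a colour class not containing it. -/
lemma IsGallai.eq_of_reachable (hc : IsGallai c) {x x' y : V} (hy : y ∈ S)
    (hxx' : (colourGraph hc.symm S r).Reachable x x')
    (hxy : ¬ (colourGraph hc.symm S r).Reachable x y) : c x y = c x' y := by
  rw [SimpleGraph.reachable_iff_reflTransGen] at hxx'
  induction hxx' with
  | refl => rfl
  | @tail a b hxa hab ih =>
    rw [ih]
    rw [← SimpleGraph.reachable_iff_reflTransGen] at hxa
    have hay : ¬ (colourGraph hc.symm S r).Adj a y := fun h => hxy (hxa.trans h.reachable)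
    have hby : ¬ (colourGraph hc.symm S r).Adj b y := fun h =>
      hxy ((hxa.trans hab.reachable).trans h.reachable)
    have hane : a ≠ y := by rintro rfl; exact hxy hxa
    have hbne : b ≠ y := by rintro rfl; exact hxy (hxa.trans hab.reachable)
    obtain ⟨haS, hbS, hne, hcol⟩ := hab
    have h1 : c a y ≠ r := fun h => hay ⟨haS, hy, hane, h⟩
    have h2 : c b y ≠ r := fun h => hby ⟨hbS, hy, hbne, h⟩
    rcases hc.triangle a b y hne hbne hane with h | h | h
    · exact absurd (h.symm.trans hcol) h2
    · exact h.symm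
    · exact absurd (h.symm.trans hcol) h1

lemma exists_not_reachable (h : ∀ x y, c x y = c y x) (hS : ¬ ColourConnects c S r) (x : V) :
    ∃ z ∈ S, ¬ (colourGraph h S r).Reachable x z := by
  by_contra! hall
  refine hS fun A hA ⟨a, ha⟩ hne => ?_
  obtain ⟨b, hb, hbA⟩ := Finset.exists_of_ssubset (hA.ssubset_of_ne hne)
  obtain ⟨p⟩ := (hall a (hA ha)).symm.trans (hall b hb)
  obtain ⟨d, -, hd1, hd2⟩ := p.exists_boundary_dart (A : Set V) ha hbA
  exact ⟨d.fst, hd1, d.snd, d.adj.2.1, hd2, d.adj.2.2.2⟩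

/-- If every colour that occurs is connected, then at most two colours occur. -/
theorem IsGallai.exists_two_colours (hc : IsGallai c) (hS : S.Nonempty)
    (hconn : ∀ x ∈ S, ∀ y ∈ S, x ≠ y → ColourConnects c S (c x y)) :
    ∃ r b, ∀ x ∈ S, ∀ y ∈ S, x ≠ y → c x y = r ∨ c x y = b := by
  classical
  induction S using Finset.strongInduction with
  | H S ih =>
    obtain ⟨v, hv⟩ := hS
    -- Every colour that occurs in `S` occurs at `v`.
    have hat : ∀ x ∈ S, ∀ y ∈ S, x ≠ y → ∃ z ∈ S, z ≠ v ∧ c v z = c x y := by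
      intro x hx y hy hxy
      obtain ⟨a, ha, z, hz, hza, hcol⟩ := hconn x hx y hy hxy {v} (by simpa using hv) (by simp) (by
        rintro h
        rw [← h, Finset.mem_singleton] at hx hy
        exact hxy (hx.trans hy.symm))
      rw [Finset.mem_singleton] at ha hza
      subst ha
      exact ⟨z, hz, hza, hcol⟩
    rcases (S.erase v).eq_empty_or_nonempty with hS' | hS'
    · refine ⟨c v v, c v v, fun x hx y hy hxy => ?_⟩
      obtain ⟨z, hz, hzv, -⟩ := hat x hx y hy hxy
      have : z ∈ S.erase v := Finset.mem_erase.2 ⟨hzv, hz⟩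
      simp [hS'] at this
    by_cases hconn' : ∀ x ∈ S.erase v, ∀ y ∈ S.erase v, x ≠ y → ColourConnects c (S.erase v) (c x y)
    · obtain ⟨r, b, hrb⟩ := ih _ (Finset.erase_ssubset hv) hS' hconn'
      by_cases hall : ∀ x ∈ S, x ≠ v → c v x = r ∨ c v x = b
      · refine ⟨r, b, fun x hx y hy hxy => ?_⟩
        obtain ⟨z, hz, hzv, hcol⟩ := hat x hx y hy hxy
        rw [← hcol]
        exact hall z hz hzv
      -- A third colour occurs only at `v`, hence on every edge at `v` since it is connected.
      · push Not at hall
        obtain ⟨x, hx, hxv, hr, hb⟩ := hall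
        have hstar : ∀ y ∈ S, y ≠ v → c v y = c v x := by
          intro y hy hyv
          obtain ⟨a, ha, z, hz, hza, hcol⟩ := hconn v hv x hx hxv.symm {y} (by simpa using hy)
            (by simp) (by rintro h; rw [← h, Finset.mem_singleton] at hv; exact hyv hv.symm)
          rw [Finset.mem_singleton] at ha hza
          subst ha
          by_cases hzv : z = v
          · subst hzv
            rw [hc.symm, hcol]
          · have := hrb a (by simp [*]) z (by simp [*]) (Ne.symm hza)
            rw [hcol] at this
            exact absurd this (by simp [hr, hb])
        refine ⟨c v x, c v x, fun y hy z hz hyz => ?_⟩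
        obtain ⟨z', hz', hzv', hcol⟩ := hat y hy z hz hyz
        rw [← hcol, hstar z' hz' hzv']
        simp
    · push Not at hconn'
      obtain ⟨x₀, hx₀, y₀, hy₀, hne₀, hdis⟩ := hconn'
      set r := c x₀ y₀ with hr
      set H := colourGraph hc.symm (S.erase v) r with hH
      have hrv : ∀ x ∈ S.erase v, ∃ a ∈ S.erase v, H.Reachable x a ∧ c v a = r := by
        intro x hx
        obtain ⟨p, hp, q, hq, hqA, hcol⟩ := hconn x₀ (Finset.mem_of_mem_erase hx₀) y₀
          (Finset.mem_of_mem_erase hy₀) hne₀ ((S.erase v).filter (H.Reachable x))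
          ((Finset.filter_subset _ _).trans (Finset.erase_subset _ _))
          ⟨x, Finset.mem_filter.2 ⟨hx, .refl x⟩⟩ (by
            intro h
            rw [← h] at hv
            simp at hv)
        rw [Finset.mem_filter] at hp hqA
        have hqv : q = v := by
          by_contra hqv
          have hq' : q ∈ S.erase v := Finset.mem_erase.2 ⟨hqv, hq⟩
          have hpq : p ≠ q := by rintro rfl; exact hqA hp
          exact hqA ⟨hq', hp.2.trans (SimpleGraph.Adj.reachable ⟨hp.1, hq', hpq, hcol⟩)⟩
        subst hqv
        exact ⟨p, hp.1, hp.2, by rw [hc.symm, hcol]⟩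
      have hout : ∀ x ∈ S.erase v, c v x ≠ r → ∀ z ∈ S.erase v, ¬ H.Reachable x z →
          c v x = c x z := by
        intro x hx hxr z hz hxz
        obtain ⟨a, ha, hza, hva⟩ := hrv z hz
        have hxa : ¬ H.Reachable x a := fun h => hxz (h.trans hza.symm)
        have hxane : x ≠ a := by rintro rfl; exact hxa (.refl x)
        have hxar : c x a ≠ r := fun h => hxa (SimpleGraph.Adj.reachable ⟨hx, ha, hxane, h⟩)
        have hcxa : c x a = c x z := by
          rw [hc.symm x a, hc.symm x z]
          exact (hc.eq_of_reachable hx hza fun h => hxz h.symm).symm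
        rcases hc.triangle v x a (Finset.ne_of_mem_erase hx).symm hxane
          (Finset.ne_of_mem_erase ha).symm with h | h | h
        · exact h.trans hcxa
        · exact absurd (h.trans hva) hxar
        · exact absurd (h.trans hva) hxr
      have hsame : ∀ x ∈ S.erase v, ∀ y ∈ S.erase v, c v x ≠ r → c v y ≠ r → c v x = c v y := by
        intro x hx y hy hxr hyr
        by_cases hxy : H.Reachable x y
        · obtain ⟨z, hz, hxz⟩ := exists_not_reachable hc.symm hdis x
          rw [hout x hx hxr z hz hxz, hout y hy hyr z hz fun h => hxz (hxy.trans h)]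
          exact hc.eq_of_reachable hz hxy hxz
        · rw [hout x hx hxr y hy hxy, hout y hy hyr x hx fun h => hxy h.symm, hc.symm]
      by_cases hex : ∃ x ∈ S.erase v, c v x ≠ r
      · obtain ⟨x, hx, hxr⟩ := hex
        refine ⟨r, c v x, fun y hy z hz hyz => ?_⟩
        obtain ⟨z', hz', hzv', hcol⟩ := hat y hy z hz hyz
        rw [← hcol]
        by_cases h : c v z' = r
        · exact .inl h
        · exact .inr (hsame z' (Finset.mem_erase.2 ⟨hzv', hz'⟩) x hx h hxr)
      · push Not at hex
        refine ⟨r, r, fun y hy z hz hyz => ?_⟩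
        obtain ⟨z', hz', hzv', hcol⟩ := hat y hy z hz hyz
        rw [← hcol]
        exact .inl (hex z' (Finset.mem_erase.2 ⟨hzv', hz'⟩))

/-- Gallai's theorem: the fibres of `f` form a partition of `S` into at least two parts such that
at most two colours, `r` and `b`, occur between the parts, and all edges between a fixed pair of
parts have the same colour. -/
theorem IsGallai.exists_partition (hc : IsGallai c) (hS : 2 ≤ S.card) :
    ∃ (f : V → V) (r b : K), (∃ x ∈ S, ∃ y ∈ S, f x ≠ f y) ∧
      (∀ x ∈ S, ∀ y ∈ S, f x ≠ f y → c x y = r ∨ c x y = b) ∧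
      ∀ x ∈ S, ∀ x' ∈ S, ∀ y ∈ S, f x = f x' → f x ≠ f y → c x y = c x' y := by
  classical
  induction S using Finset.strongInduction with
  | H S ih =>
    by_cases hconn : ∀ x ∈ S, ∀ y ∈ S, x ≠ y → ColourConnects c S (c x y)
    · obtain ⟨r, b, hrb⟩ := hc.exists_two_colours (Finset.card_pos.1 (by omega)) hconn
      refine ⟨id, r, b, ?_, hrb, ?_⟩
      · simpa using Finset.one_lt_card_iff.1 hS
      · rintro x - x' - y - rfl -
        rfl
    -- Otherwise the components of a disconnected colour are modules; recurse on representatives.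
    push Not at hconn
    obtain ⟨x₀, hx₀, y₀, hy₀, hne₀, hdis⟩ := hconn
    set r := c x₀ y₀ with hr
    set H := colourGraph hc.symm S r with hH
    let rep : V → V := fun x => (H.connectedComponentMk x).out
    have hrep : ∀ x, H.Reachable x (rep x) := fun x =>
      (SimpleGraph.ConnectedComponent.exact (Quot.out_eq (H.connectedComponentMk x))).symm
    have hrepeq : ∀ {x y}, H.Reachable x y → rep x = rep y := fun h => by
      simp only [rep, SimpleGraph.ConnectedComponent.sound h]
    have hrepS : ∀ x ∈ S, rep x ∈ S := fun x hx => mem_of_reachable hx (hrep x)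
    have hmod : ∀ x ∈ S, ∀ y ∈ S, rep x ≠ rep y → c x y = c (rep x) (rep y) := by
      intro x hx y hy hxy
      have h1 : ¬ H.Reachable x y := fun h => hxy (hrepeq h)
      rw [hc.eq_of_reachable hy (hrep x) h1, hc.symm (rep x), hc.symm (rep x)]
      exact hc.eq_of_reachable (hrepS x hx) (hrep y) fun h => h1 (h.trans (hrep x).symm).symm
    have hss : S.image rep ⊂ S := by
      refine (Finset.image_subset_iff.2 hrepS).ssubset_of_ne fun h => ?_
      have hinj : Set.InjOn rep S := Finset.card_image_iff.1 (by rw [h])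
      exact hne₀ (hinj hx₀ hy₀
        (hrepeq (SimpleGraph.Adj.reachable ⟨hx₀, hy₀, hne₀, rfl⟩)))
    have hcard : 2 ≤ (S.image rep).card := by
      obtain ⟨z, hz, hxz⟩ := exists_not_reachable hc.symm hdis x₀
      refine Finset.one_lt_card.2 ⟨rep x₀, Finset.mem_image_of_mem _ hx₀, rep z,
        Finset.mem_image_of_mem _ hz, fun h => hxz ?_⟩
      exact (hrep x₀).trans (h ▸ (hrep z).symm)
    obtain ⟨f, r', b', ⟨x, hx, y, hy, hxy⟩, h2, h3⟩ := ih _ hss hcard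
    obtain ⟨x, hxS, rfl⟩ := Finset.mem_image.1 hx
    obtain ⟨y, hyS, rfl⟩ := Finset.mem_image.1 hy
    refine ⟨f ∘ rep, r', b', ⟨x, hxS, y, hyS, hxy⟩, fun u hu w hw huw => ?_,
      fun u hu u' hu' w hw huu' huw => ?_⟩
    · rw [hmod u hu w hw fun h => huw (congrArg f h)]
      exact h2 _ (Finset.mem_image_of_mem _ hu) _ (Finset.mem_image_of_mem _ hw) huw
    · have huw' : f (rep u') ≠ f (rep w) := fun h => huw (huu'.trans h)
      rw [hmod u hu w hw fun h => huw (congrArg f h),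
        hmod u' hu' w hw fun h => huw' (congrArg f h)]
      exact h3 _ (Finset.mem_image_of_mem _ hu) _ (Finset.mem_image_of_mem _ hu') _
        (Finset.mem_image_of_mem _ hw) huu' huw

end Gallai

/-! ### Colourings without rainbow triangles and monochromatic wheels -/

section WheelFreeColouring

variable {V K : Type*} {c : V → V → K}

/-- `x` and `y` are distinct and joined in colour `r`. -/
def Edge (c : V → V → K) (r : K) (x y : V) : Prop := x ≠ y ∧ c x y = r

/-- A colouring without rainbow triangles and without monochromatic `W₅`; in `wheel`, the hub is
`v` and the rim is `p q s u`. -/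
structure IsGood (c : V → V → K) : Prop extends IsGallai c where
  wheel : ∀ r v p q s u, p ≠ s → q ≠ u → Edge c r v p → Edge c r v q → Edge c r v s →
    Edge c r v u → Edge c r p q → Edge c r q s → Edge c r s u → Edge c r u p → False

/-- No two edges of colour `r` inside `S` share a vertex. -/
def IsColourMatching (c : V → V → K) (S : Finset V) (r : K) : Prop :=
  ∀ x ∈ S, ∀ y ∈ S, ∀ z ∈ S, y ≠ z → Edge c r x y → Edge c r x z → False

/-- `w` lies outside `S` and is joined in colour `r` to all of `S`. -/
def IsColourComplete (c : V → V → K) (r : K) (w : V) (S : Finset V) : Prop :=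
  w ∉ S ∧ ∀ x ∈ S, c w x = r

/-- Only the colours `r` and `b` occur inside `S`. -/
def IsTwoColoured (c : V → V → K) (S : Finset V) (r b : K) : Prop :=
  ∀ x ∈ S, ∀ y ∈ S, x ≠ y → c x y = r ∨ c x y = b

variable {S A : Finset V} {r b : K}

lemma IsColourMatching.mono (h : IsColourMatching c S r) (hA : A ⊆ S) : IsColourMatching c A r :=
  fun x hx y hy z hz => h x (hA hx) y (hA hy) z (hA hz)

lemma IsColourComplete.mono {w : V} (h : IsColourComplete c r w S) (hA : A ⊆ S) :
    IsColourComplete c r w A :=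
  ⟨fun hw => h.1 (hA hw), fun x hx => h.2 x (hA hx)⟩

lemma IsColourComplete.edge {w x : V} (h : IsColourComplete c r w S) (hx : x ∈ S) : Edge c r w x :=
  ⟨fun e => h.1 (e ▸ hx), h.2 x hx⟩

lemma IsTwoColoured.mono (h : IsTwoColoured c S r b) (hA : A ⊆ S) : IsTwoColoured c A r b :=
  fun x hx y hy => h x (hA hx) y (hA hy)

lemma IsTwoColoured.swap (h : IsTwoColoured c S r b) : IsTwoColoured c S b r :=
  fun x hx y hy hxy => (h x hx y hy hxy).symm

namespace IsGood

lemma edge_symm (hc : IsGood c) {x y : V} (h : Edge c r x y) : Edge c r y x :=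
  ⟨h.1.symm, hc.symm y x ▸ h.2⟩

/-- Two outside vertices serve as opposite rim vertices. -/
lemma isColourMatching_of_two (hc : IsGood c) {w w' : V} (hne : w ≠ w')
    (hw : IsColourComplete c r w S) (hw' : IsColourComplete c r w' S) :
    IsColourMatching c S r := fun x hx y hy z hz hyz hxy hxz =>
  hc.wheel r x w y w' z hne hyz (hc.edge_symm (hw.edge hx)) hxy (hc.edge_symm (hw'.edge hx)) hxz
    (hw.edge hy) (hc.edge_symm (hw'.edge hy)) (hw'.edge hz) (hc.edge_symm (hw.edge hz))

/-- The complement of a matching on five vertices contains `W₅`. -/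
lemma card_le_four (hc : IsGood c) (h2 : IsTwoColoured c S r b) (hM : IsColourMatching c S r) :
    S.card ≤ 4 := by
  classical
  by_contra! hcard
  have hb : ∀ x ∈ S, ∀ y ∈ S, x ≠ y → ¬ Edge c r x y → Edge c b x y := fun x hx y hy hne h =>
    ⟨hne, (h2 x hx y hy hne).resolve_left fun h' => h ⟨hne, h'⟩⟩
  obtain ⟨x, hx, y, hy, hxy, hall⟩ : ∃ x ∈ S, ∃ y ∈ S, x ≠ y ∧ ∀ z ∈ S, z ≠ x → z ≠ y →
      Edge c b x z ∧ Edge c b y z := by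
    by_cases hex : ∃ x ∈ S, ∃ y ∈ S, Edge c r x y
    · obtain ⟨x, hx, y, hy, hxy⟩ := hex
      exact ⟨x, hx, y, hy, hxy.1, fun z hz hzx hzy =>
        ⟨hb x hx z hz hzx.symm fun h => hM x hx y hy z hz hzy.symm hxy h,
          hb y hy z hz hzy.symm fun h => hM y hy x hx z hz hzx.symm (hc.edge_symm hxy) h⟩⟩
    · push Not at hex
      obtain ⟨x, hx, y, hy, hxy⟩ := Finset.one_lt_card.1 (show 1 < S.card by omega)
      exact ⟨x, hx, y, hy, hxy, fun z hz hzx hzy =>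
        ⟨hb x hx z hz hzx.symm (hex x hx z hz), hb y hy z hz hzy.symm (hex y hy z hz)⟩⟩
  have hwheel : ∀ v ∈ (S.erase x).erase y, ∀ z ∈ (S.erase x).erase y,
      ∀ u ∈ (S.erase x).erase y, z ≠ u → Edge c b v z → Edge c b v u → False := by
    intro v hv z hz u hu hzu hvz hvu
    simp only [Finset.mem_erase] at hv hz hu
    have hv' := hall v hv.2.2 hv.2.1 hv.1
    have hz' := hall z hz.2.2 hz.2.1 hz.1
    have hu' := hall u hu.2.2 hu.2.1 hu.1
    exact hc.wheel b v x z y u hxy hzu (hc.edge_symm hv'.1) hvz (hc.edge_symm hv'.2) hvu hz'.1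
      (hc.edge_symm hz'.2) hu'.2 (hc.edge_symm hu'.1)
  obtain ⟨p, hp, q, hq, s, hs, hpq, hps, hqs⟩ :=
    Finset.two_lt_card.1 (show 2 < ((S.erase x).erase y).card by
      rw [Finset.card_erase_of_mem (Finset.mem_erase.2 ⟨hxy.symm, hy⟩),
        Finset.card_erase_of_mem hx]
      omega)
  have hsub : (S.erase x).erase y ⊆ S := (Finset.erase_subset _ _).trans (Finset.erase_subset _ _)
  have hp' := hsub hp
  have hq' := hsub hq
  have hs' := hsub hs
  by_cases h1 : Edge c r p q
  · exact hwheel s hs p hp q hq hpq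
      (hb s hs' p hp' hps.symm fun h => hM p hp' q hq' s hs' hqs h1 (hc.edge_symm h))
      (hb s hs' q hq' hqs.symm fun h =>
        hM q hq' p hp' s hs' hps (hc.edge_symm h1) (hc.edge_symm h))
  · by_cases h3 : Edge c r p s
    · exact hwheel q hq p hp s hs hps (hc.edge_symm (hb p hp' q hq' hpq h1))
        (hb q hq' s hs' hqs fun h => hM s hs' p hp' q hq' hpq (hc.edge_symm h3) (hc.edge_symm h))
    · exact hwheel p hp q hq s hs hqs (hb p hp' q hq' hpq h1) (hb p hp' s hs' hps h3)

/-- The graph of colour `r` on `S`. -/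
def graph (hc : IsGood c) (S : Finset V) (r : K) : SimpleGraph S where
  Adj x y := Edge c r x y
  symm := ⟨fun _ _ h => hc.edge_symm h⟩
  loopless := ⟨fun _ h => h.1 rfl⟩

lemma wheelFree_graph (hc : IsGood c) (S : Finset V) (r : K) : WheelFree (hc.graph S r) :=
  fun v p q s u hps hqu h1 h2 h3 h4 h5 h6 h7 h8 => hc.wheel r v p q s u
    (fun e => hps (Subtype.ext e)) (fun e => hqu (Subtype.ext e)) h1 h2 h3 h4 h5 h6 h7 h8

lemma wheelFree_compl_graph (hc : IsGood c) (h2 : IsTwoColoured c S r b) :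
    WheelFree (hc.graph S r)ᶜ := by
  have key : ∀ {x y : S}, (hc.graph S r)ᶜ.Adj x y → Edge c b x y := by
    intro x y h
    rw [SimpleGraph.compl_adj] at h
    have hne : (x : V) ≠ y := fun e => h.1 (Subtype.ext e)
    exact ⟨hne, (h2 x x.2 y y.2 hne).resolve_left fun h' => h.2 ⟨hne, h'⟩⟩
  exact fun v p q s u hps hqu h1 h2 h3 h4 h5 h6 h7 h8 => hc.wheel b v p q s u
    (fun e => hps (Subtype.ext e)) (fun e => hqu (Subtype.ext e)) (key h1) (key h2) (key h3)
    (key h4) (key h5) (key h6) (key h7) (key h8)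

lemma card_le_fourteen (hc : IsGood c) (h2 : IsTwoColoured c S r b) : S.card ≤ 14 := by
  rw [← Fintype.card_coe]
  exact _root_.card_le_fourteen (hc.wheelFree_graph S r) (hc.wheelFree_compl_graph h2)

lemma card_le_eight (hc : IsGood c) (h2 : IsTwoColoured c S r b) {w : V}
    (hw : IsColourComplete c r w S) : S.card ≤ 8 := by
  classical
  have h2' : IsTwoColoured c (insert w S) r b := by
    intro x hx y hy hxy
    rcases Finset.mem_insert.1 hx with rfl | hx'
    · exact .inl (hw.2 y (Finset.mem_of_mem_insert_of_ne hy hxy.symm))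
    · rcases Finset.mem_insert.1 hy with rfl | hy'
      · exact .inl (hc.symm x y ▸ hw.2 x hx')
      · exact h2 x hx' y hy' hxy
  have := card_nbrs_le_eight (hc.wheelFree_graph (insert w S) r) (hc.wheelFree_compl_graph h2')
    (w := ⟨w, Finset.mem_insert_self w S⟩) (A := S.subtype (· ∈ insert w S))
    (fun a ha => hw.edge (Finset.mem_subtype.1 ha))
  rwa [Finset.card_subtype, Finset.filter_true_of_mem fun x hx => Finset.mem_insert_of_mem hx]
    at this

end IsGood

end WheelFreeColouring

/-! ### The numerical bound -/

/-- The bound for sets with `m` unrestricted and `n` restricted colours, where the restricted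
colours are those in which some outside vertex is joined to everything, and all other colours are
matchings. The values for `n > 0` need not be sharp: they are large enough for the recursive
inequalities below, and small enough to give the exact values for `n = 0` and `m > 0`. -/
def wheelBound : ℕ → ℕ → ℕ
  | 0, 0 => 2
  | 0, 1 => 3
  | 0, n + 2 => n + 8
  | 1, 0 => 4
  | 1, 1 => 9
  | 1, n + 2 => 9 * n + 16
  | 2, n => 11 * 2 ^ n + 3
  | 3, n => 22 * 2 ^ n + 6
  | m + 4, n => 5 * wheelBound (m + 2) n

section WheelBound

lemma wheelBound_two_add_le (m n : ℕ) : 14 ≤ wheelBound (m + 2) n := by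
  induction m using Nat.twoStepInduction with
  | zero => simp only [wheelBound]; have := Nat.one_le_two_pow (n := n); omega
  | one => simp only [wheelBound]; have := Nat.one_le_two_pow (n := n); omega
  | more m ih _ => simp only [wheelBound]; omega

lemma two_le_wheelBound (m n : ℕ) : 2 ≤ wheelBound m n := by
  match m, n with
  | 0, 0 | 0, 1 | 0, n + 2 | 1, 0 | 1, 1 | 1, n + 2 => all_goals simp only [wheelBound]; omega
  | m + 2, n => have := wheelBound_two_add_le m n; omega

lemma nine_mul_add_le_two_pow (n : ℕ) : 9 * n + 16 ≤ 16 * 2 ^ n := by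
  induction n with
  | zero => simp
  | succ n ih => rw [pow_succ]; omega

lemma two_mul_wheelBound_le (m n : ℕ) : 2 * wheelBound m n ≤ wheelBound (m + 1) n := by
  induction m using Nat.strong_induction_on with
  | _ m ih =>
    match m, n with
    | 0, 0 | 0, 1 | 0, n + 2 => all_goals simp only [wheelBound]; omega
    | 1, 0 | 1, 1 => all_goals simp [wheelBound]
    | 1, n + 2 => simp only [wheelBound, pow_succ]; have := nine_mul_add_le_two_pow n; omega
    | 2, n => simp only [wheelBound]; omega
    | 3, n => simp only [wheelBound]; omega
    | m + 4, n =>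
      have : 2 * wheelBound (m + 2) n ≤ wheelBound (m + 1 + 2) n := ih (m + 2) (by omega)
      simp only [wheelBound]
      omega

lemma wheelBound_succ_right_add_three_le (m n : ℕ) :
    wheelBound (m + 2) (n + 1) + 3 ≤ 2 * wheelBound (m + 2) n := by
  induction m using Nat.twoStepInduction with
  | zero => simp only [wheelBound, pow_succ]; omega
  | one => simp only [wheelBound, pow_succ]; omega
  | more m ih _ => simp only [wheelBound]; omega

lemma wheelBound_succ_right_lt (m n : ℕ) :
    wheelBound m (n + 1) + 1 ≤ wheelBound (m + 1) n := by
  match m, n with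
  | 0, 0 | 0, 1 | 0, n + 2 => all_goals simp only [wheelBound]; omega
  | 1, 0 | 1, 1 => all_goals simp [wheelBound]
  | 1, n + 2 => simp only [wheelBound, pow_succ]; have := nine_mul_add_le_two_pow n; omega
  | m + 2, n =>
    have := wheelBound_succ_right_add_three_le m n
    have := two_mul_wheelBound_le (m + 2) n
    omega

lemma wheelBound_lt_succ_right (m n : ℕ) : wheelBound m n + 1 ≤ wheelBound m (n + 1) := by
  induction m using Nat.strong_induction_on with
  | _ m ih =>
    have := Nat.one_le_two_pow (n := n)
    match m, n with
    | 0, 0 | 0, 1 | 0, n + 2 | 1, 0 | 1, 1 | 1, n + 2 => all_goals simp only [wheelBound]; omega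
    | 2, n => simp only [wheelBound, pow_succ]; omega
    | 3, n => simp only [wheelBound, pow_succ]; omega
    | m + 4, n =>
      have := ih (m + 2) (by omega)
      simp only [wheelBound]
      omega

lemma eight_le_wheelBound (m n : ℕ) (h : 2 ≤ m + n) : 8 ≤ wheelBound m n := by
  match m, n with
  | 0, n + 2 | 1, 1 | 1, n + 2 => all_goals simp only [wheelBound]; omega
  | m + 2, n => have := wheelBound_two_add_le m n; omega
  | 0, 0 | 0, 1 | 1, 0 => all_goals omega

lemma wheelBound_add_two_mul_max_le (m n : ℕ) :
    wheelBound m n + 2 * max (2 * wheelBound m n) (wheelBound m (n + 1) + 3) ≤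
      wheelBound (m + 2) n := by
  match m, n with
  | 0, 0 | 0, 1 | 1, 0 | 1, 1 => all_goals simp [wheelBound]
  | 0, n + 2 | 1, n + 2 =>
    all_goals
      simp only [wheelBound, pow_succ]
      have := nine_mul_add_le_two_pow n
      omega
  | m + 2, n =>
    have := wheelBound_succ_right_add_three_le m n
    simp only [wheelBound]
    omega

lemma wheelBound_succ_right_add_max_le (m n : ℕ) :
    wheelBound m (n + 1) + 1 + max (2 * wheelBound m n) (wheelBound m (n + 1) + 3) ≤
      wheelBound (m + 2) n := by
  match m, n with
  | 0, 0 | 0, 1 | 1, 0 | 1, 1 => all_goals simp [wheelBound]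
  | 0, n + 2 | 1, n + 2 =>
    all_goals
      simp only [wheelBound, pow_succ]
      have := nine_mul_add_le_two_pow n
      omega
  | m + 2, n =>
    have := wheelBound_succ_right_add_three_le m n
    have := wheelBound_two_add_le m n
    simp only [wheelBound]
    omega

lemma wheelBound_add_max_le (m n : ℕ) :
    wheelBound m n + 1 + max (2 * wheelBound m n) (wheelBound m n + 3) ≤
      wheelBound (m + 1) (n + 1) := by
  match m, n with
  | 0, 0 | 0, 1 | 0, n + 2 | 1, 0 | 1, 1 => all_goals simp only [wheelBound]; omega
  | 1, n + 2 =>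
      simp only [wheelBound, pow_succ]
      have := nine_mul_add_le_two_pow n
      omega
  | m + 2, n =>
    have h1 := two_mul_wheelBound_le (m + 2) (n + 1)
    have h2 := wheelBound_lt_succ_right (m + 2) n
    have h3 := wheelBound_two_add_le m n
    have h4 : 3 * wheelBound (m + 2) n + 2 ≤ 2 * wheelBound (m + 2) (n + 1) := by
      clear h1 h2
      induction m using Nat.twoStepInduction with
      | zero => simp only [wheelBound, pow_succ]; have := Nat.one_le_two_pow (n := n); omega
      | one => simp only [wheelBound, pow_succ]; have := Nat.one_le_two_pow (n := n); omega
      | more m ih _ =>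
        have := ih (wheelBound_two_add_le m n)
        simp only [wheelBound] at this ⊢
        omega
    omega

end WheelBound

/-! ### The upper bound -/

section UpperBound

variable {V K : Type*} {c : V → V → K} {S A B : Finset V} {r b : K}

/-- The inductive statement: if `F` and `T` are disjoint sets of colours, every colour outside
`F ∪ T` is a matching in `S`, and every colour of `T` joins some outside vertex to all of `S`,
then `S` has at most `wheelBound |F| |T|` elements. -/
def HasWheelBound (c : V → V → K) (S : Finset V) : Prop :=
  ∀ F T : Finset K, Disjoint F T → (∀ r, r ∉ F → r ∉ T → IsColourMatching c S r) →
    (∀ r ∈ T, ∃ w, IsColourComplete c r w S) → S.card ≤ wheelBound F.card T.card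

namespace IsGood

lemma hasWheelBound_insert [DecidableEq V] (hc : IsGood c) {x : V}
    (hx : IsColourComplete c r x A) (hA : HasWheelBound c A) :
    HasWheelBound c (insert x A) := by
  classical
  intro F T hFT hM hT
  rw [Finset.card_insert_of_notMem hx.1]
  have hsub := Finset.subset_insert x A
  have hxs := Finset.mem_insert_self x A
  by_cases hrF : r ∈ F
  · have hrT : r ∉ T := Finset.disjoint_left.1 hFT hrF
    have h := hA (F.erase r) (insert r T) ?_ ?_ ?_
    · rw [Finset.card_erase_of_mem hrF, Finset.card_insert_of_notMem hrT] at h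
      have h' := wheelBound_succ_right_lt (F.card - 1) T.card
      rw [Nat.sub_add_cancel (Finset.card_pos.2 ⟨r, hrF⟩)] at h'
      omega
    · rw [Finset.disjoint_insert_right]
      exact ⟨Finset.notMem_erase r F, hFT.mono_left (Finset.erase_subset r F)⟩
    · intro s hsF hsT
      rw [Finset.mem_insert, not_or] at hsT
      exact (hM s (fun h => hsF (Finset.mem_erase.2 ⟨hsT.1, h⟩)) hsT.2).mono hsub
    · intro s hs
      rcases Finset.mem_insert.1 hs with rfl | hs
      · exact ⟨x, hx⟩
      · obtain ⟨w, hw⟩ := hT s hs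
        exact ⟨w, hw.mono hsub⟩
  by_cases hrT : r ∈ T
  · have h := hA F (T.erase r) (hFT.mono_right (Finset.erase_subset r T)) ?_ ?_
    · rw [Finset.card_erase_of_mem hrT] at h
      have h' := wheelBound_lt_succ_right F.card (T.card - 1)
      rw [Nat.sub_add_cancel (Finset.card_pos.2 ⟨r, hrT⟩)] at h'
      omega
    · intro s hsF hsT
      by_cases hsr : s = r
      · subst hsr
        obtain ⟨w, hw⟩ := hT s hrT
        exact hc.isColourMatching_of_two (fun e => hw.1 (by rwa [e])) (hw.mono hsub) hx
      · exact (hM s hsF fun h => hsT (Finset.mem_erase.2 ⟨hsr, h⟩)).mono hsub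
    · intro s hs
      obtain ⟨w, hw⟩ := hT s (Finset.mem_of_mem_erase hs)
      exact ⟨w, hw.mono hsub⟩
  · have hcard : A.card ≤ 1 := by
      rw [Finset.card_le_one]
      by_contra! ⟨y, hy, z, hz, hyz⟩
      exact hM r hrF hrT x hxs y (hsub hy) z (hsub hz) hyz (hx.edge hy) (hx.edge hz)
    have := two_le_wheelBound F.card T.card
    omega

/-- If `S` splits into two sets between which only one colour occurs, the bound is inherited. -/
lemma hasWheelBound_of_split [DecidableEq V] (hc : IsGood c) (hS : A ∪ B = S)
    (hAB : Disjoint A B) (hA0 : A.Nonempty) (hB0 : B.Nonempty)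
    (hr : ∀ x ∈ A, ∀ y ∈ B, c x y = r) (hA : HasWheelBound c A) (hB : HasWheelBound c B) :
    HasWheelBound c S := by
  classical
  subst hS
  have hr' : ∀ y ∈ B, ∀ x ∈ A, c y x = r := fun y hy x hx => hc.symm x y ▸ hr x hx y hy
  have compA : ∀ x ∈ A, IsColourComplete c r x B := fun x hx =>
    ⟨Finset.disjoint_left.1 hAB hx, hr x hx⟩
  have compB : ∀ y ∈ B, IsColourComplete c r y A := fun y hy =>
    ⟨Finset.disjoint_right.1 hAB hy, hr' y hy⟩
  by_cases hA1 : A.card = 1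
  · obtain ⟨x, rfl⟩ := Finset.card_eq_one.1 hA1
    rw [← Finset.insert_eq]
    exact hc.hasWheelBound_insert (compA x (Finset.mem_singleton_self x)) hB
  by_cases hB1 : B.card = 1
  · obtain ⟨y, rfl⟩ := Finset.card_eq_one.1 hB1
    rw [Finset.union_comm, ← Finset.insert_eq]
    exact hc.hasWheelBound_insert (compB y (Finset.mem_singleton_self y)) hA
  obtain ⟨x, hx, x', hx', hxx'⟩ := Finset.one_lt_card.1 (show 1 < A.card by
    have := Finset.card_pos.2 hA0; omega)
  obtain ⟨y, hy, y', hy', hyy'⟩ := Finset.one_lt_card.1 (show 1 < B.card by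
    have := Finset.card_pos.2 hB0; omega)
  have hMA := hc.isColourMatching_of_two hyy' (compB y hy) (compB y' hy')
  have hMB := hc.isColourMatching_of_two hxx' (compA x hx) (compA x' hx')
  intro F T hFT hM hT
  by_cases hrF : r ∈ F
  · have key : ∀ A' ⊆ A ∪ B, IsColourMatching c A' r → HasWheelBound c A' →
        A'.card ≤ wheelBound (F.card - 1) T.card := by
      intro A' hA' hMA' hW
      rw [← Finset.card_erase_of_mem hrF]
      refine hW _ T (hFT.mono_left (Finset.erase_subset r F)) (fun s hsF hsT => ?_) fun s hs => ?_
      · by_cases hsr : s = r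
        · exact hsr ▸ hMA'
        · exact (hM s (fun h => hsF (Finset.mem_erase.2 ⟨hsr, h⟩)) hsT).mono hA'
      · obtain ⟨w, hw⟩ := hT s hs
        exact ⟨w, hw.mono hA'⟩
    have h1 := key A Finset.subset_union_left hMA hA
    have h2 := key B Finset.subset_union_right hMB hB
    have h3 := two_mul_wheelBound_le (F.card - 1) T.card
    rw [Nat.sub_add_cancel (Finset.card_pos.2 ⟨r, hrF⟩)] at h3
    rw [Finset.card_union_of_disjoint hAB]
    omega
  exfalso
  have mA := fun {z} (hz : z ∈ A) => Finset.mem_union_left B hz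
  have mB := fun {z} (hz : z ∈ B) => Finset.mem_union_right A hz
  by_cases hrT : r ∈ T
  · obtain ⟨w, hw⟩ := hT r hrT
    exact hc.wheel r w x y x' y' hxx' hyy' (hw.edge (mA hx)) (hw.edge (mB hy)) (hw.edge (mA hx'))
      (hw.edge (mB hy')) ((compA x hx).edge hy) ((compB y hy).edge hx') ((compA x' hx').edge hy')
      ((compB y' hy').edge hx)
  · exact hM r hrF hrT x (mA hx) y (mB hy) y' (mB hy') hyy' ((compA x hx).edge hy)
      ((compA x hx).edge hy')

end IsGood

/-- A Gallai partition of `S`, into the fibres of `f`, with the colours `r` and `b` between the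
parts, where moreover no cut of `S` is monochromatic. -/
structure IsPrimePartition (c : V → V → K) (S : Finset V) (f : V → V) (r b : K) : Prop where
  nonconst : ∃ x ∈ S, ∃ y ∈ S, f x ≠ f y
  col : ∀ x ∈ S, ∀ y ∈ S, f x ≠ f y → c x y = r ∨ c x y = b
  mod : ∀ x ∈ S, ∀ x' ∈ S, ∀ y ∈ S, f x = f x' → f x ≠ f y → c x y = c x' y
  cut : ∀ A ⊆ S, A.Nonempty → A ≠ S → ∀ s, ∃ x ∈ A, ∃ y ∈ S, y ∉ A ∧ c x y ≠ s

namespace IsPrimePartition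

variable {f : V → V}

lemma swap (hP : IsPrimePartition c S f r b) : IsPrimePartition c S f b r :=
  ⟨hP.nonconst, fun x hx y hy h => (hP.col x hx y hy h).symm, hP.mod, hP.cut⟩

open Classical in
/-- The part containing `p`. -/
noncomputable def part (S : Finset V) (f : V → V) (p : V) : Finset V := S.filter fun x => f x = f p

open Classical in
/-- The union of the other parts joined to the part of `p` in colour `r`. -/
noncomputable def nbrs (c : V → V → K) (S : Finset V) (f : V → V) (r : K) (p : V) : Finset V :=
  S.filter fun x => f x ≠ f p ∧ c p x = r

lemma mem_part {p x : V} : x ∈ part S f p ↔ x ∈ S ∧ f x = f p := by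
  classical
  simp [part]

lemma mem_nbrs {p x : V} : x ∈ nbrs c S f r p ↔ x ∈ S ∧ f x ≠ f p ∧ c p x = r := by
  classical
  simp [nbrs]

lemma part_subset {p : V} : part S f p ⊆ S := fun _ hx => (mem_part.1 hx).1

lemma nbrs_subset {p : V} : nbrs c S f r p ⊆ S := fun _ hx => (mem_nbrs.1 hx).1

lemma part_ssubset (hP : IsPrimePartition c S f r b) {p : V} : part S f p ⊂ S := by
  refine part_subset.ssubset_of_ne fun h => ?_
  obtain ⟨x, hx, y, hy, hxy⟩ := hP.nonconst
  rw [← h, mem_part] at hx hy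
  exact hxy (hx.2.trans hy.2.symm)

/-- Every part is joined to some other part in colour `r`. -/
lemma nbrs_nonempty (hP : IsPrimePartition c S f r b) {p : V} (hp : p ∈ S) :
    (nbrs c S f r p).Nonempty := by
  obtain ⟨x, hx, y, hy, hyp, hcol⟩ := hP.cut (part S f p) part_subset
    ⟨p, mem_part.2 ⟨hp, rfl⟩⟩ hP.part_ssubset.ne b
  rw [mem_part] at hx
  have hyp' : f x ≠ f y := fun h => hyp (mem_part.2 ⟨hy, h.symm.trans hx.2⟩)
  have h := (hP.col x hx.1 y hy hyp').resolve_right hcol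
  rw [hP.mod x hx.1 p hp y hy hx.2 hyp'] at h
  exact ⟨y, mem_nbrs.2 ⟨hy, fun e => hyp' (hx.2.trans e.symm), h⟩⟩

lemma ne (hP : IsPrimePartition c S f r b) : r ≠ b := by
  rintro rfl
  obtain ⟨x, hx, -⟩ := hP.nonconst
  obtain ⟨x, hx, y, hy, hyp, hcol⟩ := hP.cut (part S f x) part_subset
    ⟨x, mem_part.2 ⟨hx, rfl⟩⟩ hP.part_ssubset.ne r
  rw [mem_part] at hx
  rcases hP.col x hx.1 y hy fun h => hyp (mem_part.2 ⟨hy, h.symm.trans hx.2⟩) with h | h <;>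
    exact hcol h

lemma isColourComplete_part (hc : IsGood c) (hP : IsPrimePartition c S f r b) {p x : V}
    (hp : p ∈ S) (hx : x ∈ nbrs c S f r p) : IsColourComplete c r x (part S f p) := by
  rw [mem_nbrs] at hx
  refine ⟨fun h => hx.2.1 (mem_part.1 h).2, fun y hy => ?_⟩
  rw [mem_part] at hy
  rw [hc.symm, hP.mod y hy.1 p hp x hx.1 hy.2 fun h => hx.2.1 (h.symm.trans hy.2)]
  exact hx.2.2

lemma isColourComplete_nbrs (hP : IsPrimePartition c S f r b) {p q : V}
    (hp : p ∈ S) (hq : q ∈ part S f p) : IsColourComplete c r q (nbrs c S f r p) := by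
  rw [mem_part] at hq
  refine ⟨fun h => (mem_nbrs.1 h).2.1 hq.2, fun y hy => ?_⟩
  rw [mem_nbrs] at hy
  rw [hP.mod q hq.1 p hp y hy.1 hq.2 fun h => hy.2.1 (h.symm.trans hq.2)]
  exact hy.2.2

lemma card_le (hP : IsPrimePartition c S f r b) {p : V} (hp : p ∈ S) :
    S.card ≤ (part S f p).card + (nbrs c S f r p).card + (nbrs c S f b p).card := by
  classical
  refine (Finset.card_le_card (t := part S f p ∪ nbrs c S f r p ∪ nbrs c S f b p)
    fun x hx => ?_).trans ((Finset.card_union_le _ _).trans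
      (Nat.add_le_add_right (Finset.card_union_le _ _) _))
  simp only [Finset.mem_union, mem_part, mem_nbrs]
  by_cases h : f x = f p
  · simp [hx, h]
  · rcases hP.col p hp x hx fun e => h e.symm with h' | h' <;> simp [hx, h, h']

/-- A colour between the parts cannot be a matching: two vertices joined in it would be twins, and
cutting them off would give a monochromatic cut. -/
lemma not_isColourMatching (hc : IsGood c) (hP : IsPrimePartition c S f r b) (hS : 3 ≤ S.card) :
    ¬ IsColourMatching c S r := by
  classical
  intro hM
  obtain ⟨p, hp, -⟩ := hP.nonconst
  obtain ⟨x, hx⟩ := hP.nbrs_nonempty hp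
  have hxp := hP.isColourComplete_part hc hp hx
  have hpx := hP.isColourComplete_nbrs hp (mem_part.2 ⟨hp, rfl⟩)
  rw [mem_nbrs] at hx
  have edge_px : Edge c r p x := hpx.edge (mem_nbrs.2 hx)
  have hp1 : ∀ q ∈ S, f q = f p → q = p := by
    intro q hq hqp
    by_contra hne
    exact hM x hx.1 q hq p hp hne (hxp.edge (mem_part.2 ⟨hq, hqp⟩)) (hc.edge_symm edge_px)
  have hx1 : ∀ q ∈ S, f q = f x → q = x := by
    intro q hq hqx
    by_contra hne
    have hfp : f x ≠ f p := hx.2.1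
    refine hM p hp q hq x hx.1 hne ⟨fun e => hfp ?_, ?_⟩ edge_px
    · rw [e, hqx]
    · rw [hc.symm, hP.mod q hq x hx.1 p hp hqx (hqx ▸ hfp), hc.symm]
      exact hx.2.2
  obtain ⟨a, ha, z, hz, hza, hcol⟩ := hP.cut {p, x} (by simp [Finset.insert_subset_iff, hp, hx.1])
    (by simp) (by rintro rfl; have := Finset.card_le_two (a := p) (b := x); omega) b
  simp only [Finset.mem_insert, Finset.mem_singleton, not_or] at ha hza
  have hzp : f p ≠ f z := fun e => hza.1 (hp1 z hz e.symm)
  have hzx : f x ≠ f z := fun e => hza.2 (hx1 z hz e.symm)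
  rcases ha with rfl | rfl
  · exact hM a hp x hx.1 z hz (Ne.symm hza.2) edge_px
      ⟨Ne.symm hza.1, (hP.col a hp z hz hzp).resolve_right hcol⟩
  · exact hM a hx.1 p hp z hz (Ne.symm hza.1) (hc.edge_symm edge_px)
      ⟨Ne.symm hza.2, (hP.col a hx.1 z hz hzx).resolve_right hcol⟩

/-- If `p` had a single neighbour vertex in each colour outside its part, one of the two would be
cut off by a single colour. -/
lemma two_le_card_nbrs (hc : IsGood c) (hP : IsPrimePartition c S f r b) {p : V} (hp : p ∈ S)
    (hr : (nbrs c S f r p).card ≤ 1) : 2 ≤ (nbrs c S f b p).card := by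
  by_contra! hb
  obtain ⟨x, hx⟩ := hP.nbrs_nonempty hp
  obtain ⟨y, hy⟩ := hP.swap.nbrs_nonempty hp
  have hx1 : ∀ z ∈ nbrs c S f r p, z = x := fun z hz => Finset.card_le_one.1 hr z hz x hx
  have hy1 : ∀ z ∈ nbrs c S f b p, z = y := fun z hz =>
    Finset.card_le_one.1 (Nat.le_of_lt_succ hb) z hz y hy
  have hxS := mem_nbrs.1 hx
  have hyS := mem_nbrs.1 hy
  have hxy : f x ≠ f y := by
    intro h
    have := hP.mod x hxS.1 y hyS.1 p hp h hxS.2.1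
    rw [hc.symm x, hc.symm y, hxS.2.2, hyS.2.2] at this
    exact hP.ne this
  have hcases : ∀ z ∈ S, z ∈ part S f p ∨ z = x ∨ z = y := by
    intro z hz
    by_cases h : f z = f p
    · exact .inl (mem_part.2 ⟨hz, h⟩)
    · rcases hP.col p hp z hz fun e => h e.symm with h' | h'
      · exact .inr (.inl (hx1 z (mem_nbrs.2 ⟨hz, h, h'⟩)))
      · exact .inr (.inr (hy1 z (mem_nbrs.2 ⟨hz, h, h'⟩)))
  rcases hP.col x hxS.1 y hyS.1 hxy with h | h
  · obtain ⟨a, ha, z, hz, hza, hcol⟩ := hP.cut {x} (by simpa using hxS.1) (by simp)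
      (by rintro e; rw [← e, Finset.mem_singleton] at hp; exact hxS.2.1 (by rw [hp])) r
    rw [Finset.mem_singleton] at ha hza
    subst ha
    rcases hcases z hz with h' | rfl | rfl
    · exact hcol ((hP.isColourComplete_part hc hp hx).2 z h')
    · exact hza rfl
    · exact hcol h
  · obtain ⟨a, ha, z, hz, hza, hcol⟩ := hP.cut {y} (by simpa using hyS.1) (by simp)
      (by rintro e; rw [← e, Finset.mem_singleton] at hp; exact hyS.2.1 (by rw [hp])) b
    rw [Finset.mem_singleton] at ha hza
    subst ha
    rcases hcases z hz with h' | rfl | rfl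
    · exact hcol ((hP.swap.isColourComplete_part hc hp hy).2 z h')
    · exact hcol (hc.symm _ _ ▸ h)
    · exact hza rfl

lemma isTwoColoured (hP : IsPrimePartition c S f r b) (hA : A ⊆ S) (hf : Set.InjOn f A) :
    IsTwoColoured c A r b := fun x hx y hy hxy =>
  hP.col x (hA hx) y (hA hy) fun h => hxy (hf hx hy h)

/-- The neighbours, in a colour `r`, of a part with at least two elements. Here `α` bounds the
sets in which both colours `r` and `b` are matchings, and `β` those in which `r` is a matching and
`b` is restricted by an outside vertex. If two parts among the neighbours have more than one
element, there is no room for any other neighbour. -/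
lemma card_nbrs_le (hc : IsGood c) (hP : IsPrimePartition c S f r b) {p p' : V} (hp : p ∈ S)
    (hp' : p' ∈ part S f p) (hne : p ≠ p') {α β : ℕ}
    (hα : ∀ A ⊂ S, IsColourMatching c A r → IsColourMatching c A b → A.card ≤ α)
    (hβ : ∀ A ⊂ S, IsColourMatching c A r → (∃ y ∈ S, IsColourComplete c b y A) → A.card ≤ β) :
    (nbrs c S f r p).card ≤ max (2 * α) (β + 3) := by
  classical
  set X := nbrs c S f r p with hX
  have hXS : X ⊆ S := nbrs_subset
  have hMX : IsColourMatching c X r := hc.isColourMatching_of_two hne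
    (hP.isColourComplete_nbrs hp (mem_part.2 ⟨hp, rfl⟩)) (hP.isColourComplete_nbrs hp hp')
  have hpart : ∀ x ∈ X, part S f x ⊆ X := fun x hx z hz => by
    rw [mem_part] at hz
    have hx' := mem_nbrs.1 hx
    refine mem_nbrs.2 ⟨hz.1, hz.2 ▸ hx'.2.1, ?_⟩
    rw [hc.symm, hP.mod z hz.1 x hx'.1 p hp hz.2 (hz.2 ▸ hx'.2.1), hc.symm]
    exact hx'.2.2
  by_cases hinj : Set.InjOn f X
  · obtain ⟨x, hx⟩ := hP.nbrs_nonempty hp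
    obtain ⟨y, hy⟩ := hP.swap.nbrs_nonempty (hXS hx)
    have h1 := hβ (part S f x) hP.part_ssubset (hMX.mono (hpart x hx))
      ⟨y, nbrs_subset hy, hP.swap.isColourComplete_part hc (hXS hx) hy⟩
    have h0 : 0 < (part S f x).card := Finset.card_pos.2 ⟨x, mem_part.2 ⟨hXS hx, rfl⟩⟩
    have := hc.card_le_four (hP.isTwoColoured hXS hinj) hMX
    omega
  -- Between a part with two elements and the rest of `X` only the colour `b` occurs.
  have hblue : ∀ y ∈ X, ∀ y' ∈ X, y ≠ y' → f y = f y' → ∀ z ∈ X, f z ≠ f y →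
      IsColourComplete c b z (part S f y) := by
    intro y hy y' hy' hyy' hfy z hz hzy
    have hcol : c z y = b := by
      refine (hP.col z (hXS hz) y (hXS hy) hzy).resolve_left fun h => ?_
      refine hMX z hz y hy y' hy' hyy' ⟨fun e => hzy (by rw [e]), h⟩
        ⟨fun e => hzy (by rw [e, hfy]), ?_⟩
      rw [hc.symm, ← hP.mod y (hXS hy) y' (hXS hy') z (hXS hz) hfy (Ne.symm hzy), hc.symm]
      exact h
    exact hP.swap.isColourComplete_part hc (hXS hy)
      (mem_nbrs.2 ⟨hXS hz, hzy, hc.symm z y ▸ hcol⟩)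
  rw [Set.InjOn] at hinj
  push Not at hinj
  obtain ⟨y, hy, y', hy', hfy, hyy'⟩ := hinj
  rw [Finset.mem_coe] at hy hy'
  have hy1 : y ∈ part S f y := mem_part.2 ⟨hXS hy, rfl⟩
  have hy1' : y' ∈ part S f y := mem_part.2 ⟨hXS hy', hfy.symm⟩
  have hcardX : X.card ≤ (part S f y).card + (X.filter fun z => f z ≠ f y).card := by
    refine (Finset.card_le_card (t := part S f y ∪ X.filter fun z => f z ≠ f y)
      fun z hz => ?_).trans (Finset.card_union_le _ _)
    simp only [Finset.mem_union, mem_part, Finset.mem_filter]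
    by_cases h : f z = f y
    · exact .inl ⟨hXS hz, h⟩
    · exact .inr ⟨hz, h⟩
  set Z := X.filter fun z => f z ≠ f y with hZ
  have hZX : Z ⊆ X := Finset.filter_subset _ _
  by_cases hinj : Set.InjOn f Z
  -- The other neighbours form, together with `y`, a two-coloured set.
  · obtain ⟨x, hx⟩ := hP.swap.nbrs_nonempty (hXS hy)
    have h1 := hβ _ hP.part_ssubset (hMX.mono (hpart y hy))
      ⟨x, nbrs_subset hx, hP.swap.isColourComplete_part hc (hXS hy) hx⟩
    have hyZ : y ∉ Z := fun h => (Finset.mem_filter.1 h).2 rfl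
    have hsub : insert y Z ⊆ X := Finset.insert_subset hy hZX
    have h4 := hc.card_le_four (hP.isTwoColoured (hsub.trans hXS) ?_) (hMX.mono hsub)
    · rw [Finset.card_insert_of_notMem hyZ] at h4
      omega
    · rw [Finset.coe_insert, Set.injOn_insert (by simpa using hyZ)]
      refine ⟨hinj, ?_⟩
      rintro ⟨z, hz, hzy⟩
      exact (Finset.mem_filter.1 hz).2 hzy
  · rw [Set.InjOn] at hinj
    push Not at hinj
    obtain ⟨z, hz, z', hz', hfz, hzz'⟩ := hinj
    rw [Finset.mem_coe] at hz hz'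
    have hzy := (Finset.mem_filter.1 hz).2
    have hzy' := (Finset.mem_filter.1 hz').2
    have hzc := hblue y hy y' hy' hyy' hfy z (hZX hz) hzy
    have hzc' := hblue y hy y' hy' hyy' hfy z' (hZX hz') hzy'
    have hyc := hblue z (hZX hz) z' (hZX hz') hzz' hfz y hy (Ne.symm hzy)
    have hyc' := hblue z (hZX hz) z' (hZX hz') hzz' hfz y' hy' (hfy ▸ Ne.symm hzy)
    have hz1 : z ∈ part S f z := mem_part.2 ⟨hXS (hZX hz), rfl⟩
    have hz1' : z' ∈ part S f z := mem_part.2 ⟨hXS (hZX hz'), hfz.symm⟩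
    have h1 := hα _ hP.part_ssubset (hMX.mono (hpart y hy))
      (hc.isColourMatching_of_two hzz' hzc hzc')
    have h2 := hα _ hP.part_ssubset (hMX.mono (hpart z (hZX hz)))
      (hc.isColourMatching_of_two hyy' hyc hyc')
    have h3 : Z.card ≤ (part S f z).card := by
      refine Finset.card_le_card fun u hu => mem_part.2 ⟨hXS (hZX hu), ?_⟩
      by_contra huz
      have hu1 := hblue y hy y' hy' hyy' hfy u (hZX hu) (Finset.mem_filter.1 hu).2
      have hu2 := hblue z (hZX hz) z' (hZX hz') hzz' hfz u (hZX hu) huz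
      exact hc.wheel b u y z y' z' hyy' hzz' (hu1.edge hy1) (hu2.edge hz1) (hu1.edge hy1')
        (hu2.edge hz1') (hyc.edge hz1) (hzc.edge hy1') (hyc'.edge hz1') (hzc'.edge hy1)
    omega

end IsPrimePartition
end UpperBound

section UpperBound

variable {V K : Type*} {c : V → V → K} {S : Finset V} {r b : K} {f : V → V}

open IsPrimePartition

/-- A nontrivial part, when both colours between the parts are unrestricted. -/
lemma IsPrimePartition.card_le_of_mem_of_mem [DecidableEq K] (hc : IsGood c)
    (hP : IsPrimePartition c S f r b) (ih : ∀ A ⊂ S, HasWheelBound c A) {F T : Finset K}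
    (hFT : Disjoint F T) (hM : ∀ r, r ∉ F → r ∉ T → IsColourMatching c S r)
    (hT : ∀ r ∈ T, ∃ w, IsColourComplete c r w S) {p p' : V} (hp : p ∈ S)
    (hp' : p' ∈ part S f p) (hne : p ≠ p') (hr : r ∈ F) (hb : b ∈ F) :
    S.card ≤ wheelBound F.card T.card := by
  have hrb := hP.ne
  have hbr : b ∈ F.erase r := Finset.mem_erase.2 ⟨hrb.symm, hb⟩
  have hF2 : F.card - 2 + 2 = F.card :=
    Nat.sub_add_cancel (Finset.one_lt_card.2 ⟨r, hr, b, hb, hrb⟩)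
  have hcardF : ((F.erase r).erase b).card = F.card - 2 := by
    rw [Finset.card_erase_of_mem hbr, Finset.card_erase_of_mem hr]
    rfl
  have hα : ∀ A ⊂ S, IsColourMatching c A r → IsColourMatching c A b →
      A.card ≤ wheelBound (F.card - 2) T.card := by
    intro A hA hMr hMb
    rw [← hcardF]
    refine ih A hA _ T (hFT.mono_left ((Finset.erase_subset _ _).trans (Finset.erase_subset _ _)))
      (fun s hsF hsT => ?_) fun s hs => (hT s hs).imp fun w hw => hw.mono hA.subset
    simp only [Finset.mem_erase, not_and] at hsF
    by_cases h1 : s = b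
    · exact h1 ▸ hMb
    by_cases h2 : s = r
    · exact h2 ▸ hMr
    · exact (hM s (hsF h1 h2) hsT).mono hA.subset
  have hβ : ∀ s t, s ∈ F → t ∈ F → s ≠ t → ((F.erase s).erase t).card = F.card - 2 →
      ∀ A ⊂ S, IsColourMatching c A s → (∃ y ∈ S, IsColourComplete c t y A) →
      A.card ≤ wheelBound (F.card - 2) (T.card + 1) := by
    rintro s t hs ht hst hcard A hA hMs ⟨y, -, hy⟩
    have htT : t ∉ T := Finset.disjoint_left.1 hFT ht
    rw [← hcard, ← Finset.card_insert_of_notMem htT]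
    refine ih A hA _ _ ?_ (fun u huF huT => ?_) fun u hu => ?_
    · rw [Finset.disjoint_insert_right]
      exact ⟨Finset.notMem_erase _ _, hFT.mono_left
        ((Finset.erase_subset _ _).trans (Finset.erase_subset _ _))⟩
    · simp only [Finset.mem_erase, not_and, Finset.mem_insert, not_or] at huF huT
      by_cases h2 : u = s
      · exact h2 ▸ hMs
      · exact (hM u (huF huT.1 h2) huT.2).mono hA.subset
    · rcases Finset.mem_insert.1 hu with rfl | hu
      · exact ⟨y, hy⟩
      · exact (hT u hu).imp fun w hw => hw.mono hA.subset
  have hβr := hβ r b hr hb hrb hcardF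
  have hβb := hβ b r hb hr hrb.symm (by rw [Finset.erase_right_comm, hcardF])
  have hXr := hP.card_nbrs_le hc hp hp' hne hα hβr
  have hXb := hP.swap.card_nbrs_le hc hp hp' hne (fun A hA h1 h2 => hα A hA h2 h1) hβb
  have hcard := hP.card_le hp
  have hMpart : ∀ {s t}, IsPrimePartition c S f s t → 2 ≤ (nbrs c S f s p).card →
      IsColourMatching c (part S f p) s := by
    intro s t hQ h
    obtain ⟨x, hx, y, hy, hxy⟩ := Finset.one_lt_card.1 h
    exact hc.isColourMatching_of_two hxy (hQ.isColourComplete_part hc hp hx)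
      (hQ.isColourComplete_part hc hp hy)
  have h1 := wheelBound_add_two_mul_max_le (F.card - 2) T.card
  have h2 := wheelBound_succ_right_add_max_le (F.card - 2) T.card
  rw [hF2] at h1 h2
  obtain ⟨x, hx⟩ := hP.nbrs_nonempty hp
  obtain ⟨y, hy⟩ := hP.swap.nbrs_nonempty hp
  by_cases hr1 : (nbrs c S f r p).card ≤ 1
  · have := hβb _ hP.part_ssubset (hMpart hP.swap (hP.two_le_card_nbrs hc hp hr1))
      ⟨x, nbrs_subset hx, hP.isColourComplete_part hc hp hx⟩
    omega
  by_cases hb1 : (nbrs c S f b p).card ≤ 1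
  · have := hβr _ hP.part_ssubset (hMpart hP (hP.swap.two_le_card_nbrs hc hp hb1))
      ⟨y, nbrs_subset hy, hP.swap.isColourComplete_part hc hp hy⟩
    omega
  · have := hα _ hP.part_ssubset (hMpart hP (by omega)) (hMpart hP.swap (by omega))
    omega

/-- In a restricted colour, a nontrivial part has only one neighbour vertex. -/
lemma IsPrimePartition.card_nbrs_le_one (hc : IsGood c) (hP : IsPrimePartition c S f r b) {w : V}
    (hw : IsColourComplete c r w S) {p p' : V} (hp : p ∈ S) (hp' : p' ∈ part S f p)
    (hne : p ≠ p') : (nbrs c S f r p).card ≤ 1 := by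
  rw [Finset.card_le_one]
  by_contra! ⟨x, hx, y, hy, hxy⟩
  have h1 := hP.isColourComplete_nbrs hp (mem_part.2 ⟨hp, rfl⟩)
  have h2 := hP.isColourComplete_nbrs hp hp'
  exact hc.wheel r w p x p' y hne hxy (hw.edge hp) (hw.edge (nbrs_subset hx))
    (hw.edge (part_subset hp')) (hw.edge (nbrs_subset hy)) (h1.edge hx) (hc.edge_symm (h2.edge hx))
    (h2.edge hy) (hc.edge_symm (h1.edge hy))

/-- A nontrivial part, when exactly one of the colours between the parts is restricted. -/
lemma IsPrimePartition.card_le_of_mem_right_of_mem [DecidableEq K] (hc : IsGood c)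
    (hP : IsPrimePartition c S f r b) (ih : ∀ A ⊂ S, HasWheelBound c A) {F T : Finset K}
    (hFT : Disjoint F T) (hM : ∀ r, r ∉ F → r ∉ T → IsColourMatching c S r)
    (hT : ∀ r ∈ T, ∃ w, IsColourComplete c r w S) {p p' : V} (hp : p ∈ S)
    (hp' : p' ∈ part S f p) (hne : p ≠ p') (hr : r ∈ T) (hb : b ∈ F) :
    S.card ≤ wheelBound F.card T.card := by
  obtain ⟨w, hw⟩ := hT r hr
  have hα : ∀ A ⊂ S, IsColourMatching c A r → IsColourMatching c A b →
      A.card ≤ wheelBound (F.card - 1) (T.card - 1) := by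
    intro A hA hMr hMb
    rw [← Finset.card_erase_of_mem hb, ← Finset.card_erase_of_mem hr]
    refine ih A hA _ _ ((hFT.mono_left (Finset.erase_subset _ _)).mono_right
      (Finset.erase_subset _ _)) (fun s hsF hsT => ?_) fun s hs =>
        (hT s (Finset.mem_of_mem_erase hs)).imp fun w hw => hw.mono hA.subset
    simp only [Finset.mem_erase, not_and] at hsF hsT
    by_cases h1 : s = b
    · exact h1 ▸ hMb
    by_cases h2 : s = r
    · exact h2 ▸ hMr
    · exact (hM s (hsF h1) (hsT h2)).mono hA.subset
  have hMr : ∀ A ⊂ S, (∃ y ∈ S, IsColourComplete c r y A) → IsColourMatching c A r := by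
    rintro A hA ⟨y, hyS, hy⟩
    exact hc.isColourMatching_of_two (fun e => hw.1 (by rwa [e])) (hw.mono hA.subset) hy
  have h1 := hP.card_nbrs_le_one hc hw hp hp' hne
  have h2 := hP.swap.card_nbrs_le hc hp hp' hne (fun A hA hMb hMr => hα A hA hMr hMb)
    (fun A hA hMb hy => hα A hA (hMr A hA hy) hMb)
  obtain ⟨x, hx⟩ := hP.nbrs_nonempty hp
  obtain ⟨y, hy, z, hz, hyz⟩ := Finset.one_lt_card.1 (hP.two_le_card_nbrs hc hp h1)
  have h3 := hα _ hP.part_ssubset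
    (hMr _ hP.part_ssubset ⟨x, nbrs_subset hx, hP.isColourComplete_part hc hp hx⟩)
    (hc.isColourMatching_of_two hyz (hP.swap.isColourComplete_part hc hp hy)
      (hP.swap.isColourComplete_part hc hp hz))
  have h4 := wheelBound_add_max_le (F.card - 1) (T.card - 1)
  rw [Nat.sub_add_cancel (Finset.card_pos.2 ⟨b, hb⟩),
    Nat.sub_add_cancel (Finset.card_pos.2 ⟨r, hr⟩)] at h4
  have h5 := hP.card_le hp
  omega

lemma IsPrimePartition.hasWheelBound (hc : IsGood c) (hP : IsPrimePartition c S f r b)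
    (hS : 3 ≤ S.card) (ih : ∀ A ⊂ S, HasWheelBound c A) : HasWheelBound c S := by
  classical
  intro F T hFT hM hT
  have hrb := hP.ne
  have hr : r ∈ F ∨ r ∈ T := by
    by_contra! h
    exact hP.not_isColourMatching hc hS (hM r h.1 h.2)
  have hb : b ∈ F ∨ b ∈ T := by
    by_contra! h
    exact hP.swap.not_isColourMatching hc hS (hM b h.1 h.2)
  by_cases hinj : Set.InjOn f S
  · have h2 := hP.isTwoColoured subset_rfl hinj
    have hpair : 2 ≤ F.card + T.card := by
      rw [← Finset.card_union_of_disjoint hFT]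
      exact Finset.one_lt_card.2 ⟨r, Finset.mem_union.2 hr, b, Finset.mem_union.2 hb, hrb⟩
    have h8 := eight_le_wheelBound _ _ hpair
    rcases hr with hr | hr
    · rcases hb with hb | hb
      · have := wheelBound_two_add_le (F.card - 2) T.card
        rw [Nat.sub_add_cancel (Finset.one_lt_card.2 ⟨r, hr, b, hb, hrb⟩)] at this
        exact (hc.card_le_fourteen h2).trans this
      · obtain ⟨w, hw⟩ := hT b hb
        exact (hc.card_le_eight h2.swap hw).trans h8
    · obtain ⟨w, hw⟩ := hT r hr
      exact (hc.card_le_eight h2 hw).trans h8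
  rw [Set.InjOn] at hinj
  push Not at hinj
  obtain ⟨p, hp, p', hp', hpp', hne⟩ := hinj
  rw [Finset.mem_coe] at hp hp'
  replace hp' : p' ∈ part S f p := mem_part.2 ⟨hp', hpp'.symm⟩
  rcases hr with hr | hr <;> rcases hb with hb | hb
  · exact hP.card_le_of_mem_of_mem hc ih hFT hM hT hp hp' hne hr hb
  · exact hP.swap.card_le_of_mem_right_of_mem hc ih hFT hM hT hp hp' hne hb hr
  · exact hP.card_le_of_mem_right_of_mem hc ih hFT hM hT hp hp' hne hr hb
  · obtain ⟨w, hw⟩ := hT r hr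
    obtain ⟨w', hw'⟩ := hT b hb
    have h1 := hP.card_nbrs_le_one hc hw hp hp' hne
    have h2 := hP.swap.card_nbrs_le_one hc hw' hp hp' hne
    have h3 := hP.two_le_card_nbrs hc hp h1
    omega

theorem IsGood.hasWheelBound (hc : IsGood c) (S : Finset V) : HasWheelBound c S := by
  classical
  induction S using Finset.strongInduction with
  | H S ih =>
    by_cases hS : 3 ≤ S.card
    swap
    · intro F T _ _ _
      have := two_le_wheelBound F.card T.card
      omega
    by_cases hcut : ∀ A ⊆ S, A.Nonempty → A ≠ S → ∀ s, ∃ x ∈ A, ∃ y ∈ S, y ∉ A ∧ c x y ≠ s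
    · obtain ⟨f, r, b, h1, h2, h3⟩ := hc.exists_partition (show 2 ≤ S.card by omega)
      exact IsPrimePartition.hasWheelBound hc ⟨h1, h2, h3, hcut⟩ hS ih
    · push Not at hcut
      obtain ⟨A, hA, hA0, hAS, s, hs⟩ := hcut
      have hss := hA.ssubset_of_ne hAS
      refine hc.hasWheelBound_of_split (Finset.union_sdiff_of_subset hA) Finset.disjoint_sdiff hA0
        (Finset.sdiff_nonempty.2 fun h => hAS (hA.antisymm h))
        (fun x hx y hy => hs x hx y (Finset.mem_sdiff.1 hy).1 (Finset.mem_sdiff.1 hy).2)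
        (ih A hss) (ih _ ?_)
      obtain ⟨a, ha⟩ := hA0
      exact (Finset.sdiff_subset).ssubset_of_ne fun h => by
        have := hA ha
        rw [← h] at this
        exact (Finset.mem_sdiff.1 this).2 ha

theorem IsGood.card_le [Fintype V] [Fintype K] (hc : IsGood c) :
    Fintype.card V ≤ wheelBound (Fintype.card K) 0 := by
  simpa using hc.hasWheelBound Finset.univ Finset.univ ∅ (Finset.disjoint_empty_right _)
    (by simp) (by simp)

end UpperBound

/-! ### Translation to edge labellings -/

section Labelling

variable {V K : Type*} {c : V → V → K}

lemma sym2_eq_of_colour_eq {col : Fin 3 → Fin 3 → K} (hs : ∀ i j, col i j = col j i)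
    (h1 : col 0 1 ≠ col 1 2) (h2 : col 1 2 ≠ col 0 2) (h3 : col 0 1 ≠ col 0 2) {i j k l : Fin 3}
    (hij : i ≠ j) (hkl : k ≠ l) (h : col i j = col k l) : s(i, j) = s(k, l) := by
  have key : ∀ i j : Fin 3, i ≠ j → (s(i, j) = s(0, 1) ∧ col i j = col 0 1) ∨
      (s(i, j) = s(1, 2) ∧ col i j = col 1 2) ∨ (s(i, j) = s(0, 2) ∧ col i j = col 0 2) := by
    intro i j hij
    fin_cases i <;> fin_cases j
    · exact absurd rfl hij
    · exact .inl ⟨rfl, rfl⟩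
    · exact .inr (.inr ⟨rfl, rfl⟩)
    · exact .inl ⟨Sym2.eq_swap, hs _ _⟩
    · exact absurd rfl hij
    · exact .inr (.inl ⟨rfl, rfl⟩)
    · exact .inr (.inr ⟨Sym2.eq_swap, hs _ _⟩)
    · exact .inr (.inl ⟨Sym2.eq_swap, hs _ _⟩)
    · exact absurd rfl hij
  rcases key i j hij with ⟨e, h'⟩ | ⟨e, h'⟩ | ⟨e, h'⟩ <;>
    rcases key k l hkl with ⟨e', h''⟩ | ⟨e', h''⟩ | ⟨e', h''⟩ <;> rw [h', h''] at h <;>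
    first
    | exact e.trans e'.symm
    | exact absurd h (by assumption)
    | exact absurd h.symm (by assumption)

lemma injective_wheel {v p q s u : V} (h1 : v ≠ p) (h2 : v ≠ q) (h3 : v ≠ s) (h4 : v ≠ u)
    (h5 : p ≠ q) (h6 : p ≠ s) (h7 : p ≠ u) (h8 : q ≠ s) (h9 : q ≠ u) (h10 : s ≠ u) :
    Function.Injective (Sum.elim (fun _ : Unit => v) ![p, q, s, u]) := by
  have hv : ∀ i, v ≠ ![p, q, s, u] i := by
    intro i
    fin_cases i <;> assumption
  rintro (i | i) (j | j) hij
  · rfl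
  · exact absurd hij (hv j)
  · exact absurd hij.symm (hv i)
  · congr 1
    fin_cases i <;> fin_cases j <;> first | rfl | (exfalso; simp at hij; simp_all)

/-- The function `c` represents the edge labelling `C`; its values on the diagonal play no role. -/
lemma hasRainbowCopy_or_hasMonochromaticCopy_iff {C : SimpleGraph.TopEdgeLabeling V K}
    (hC : ∀ x y h, C.get x y h = c x y) (hsymm : ∀ x y, c x y = c y x) :
    (HasRainbowCopy C (⊤ : SimpleGraph (Fin 3)) ∨ HasMonochromaticCopy C (wheelGraph 5)) ↔
      ¬ IsGood c := by
  have hE : ∀ r x y, (C.labelGraph r).Adj x y ↔ Edge c r x y := by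
    intro r x y
    rw [SimpleGraph.TopEdgeLabeling.labelGraph_adj]
    simp only [hC, exists_prop]
    rfl
  constructor
  · rintro (⟨f, hf⟩ | ⟨r, ⟨f⟩⟩) hc
    · have key : ∀ i j k l : Fin 3, ∀ (hij : i ≠ j) (hkl : k ≠ l), c (f i) (f j) = c (f k) (f l) →
          s(i, j) = s(k, l) := by
        intro i j k l hij hkl h
        have := @hf ⟨s(i, j), hij⟩ ⟨s(k, l), hkl⟩
          ((hC (f i) (f j) (f.injective.ne hij)).trans
            (h.trans (hC (f k) (f l) (f.injective.ne hkl)).symm))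
        exact congrArg Subtype.val this
      have hne : ∀ i j : Fin 3, i ≠ j → f i ≠ f j := fun i j h e => h (f.injective e)
      rcases hc.triangle (f 0) (f 1) (f 2) (hne _ _ (by decide)) (hne _ _ (by decide))
        (hne _ _ (by decide)) with h | h | h
      · exact absurd (key 0 1 1 2 (by decide) (by decide) h) (by decide)
      · exact absurd (key 1 2 0 2 (by decide) (by decide) h) (by decide)
      · exact absurd (key 0 1 0 2 (by decide) (by decide) h) (by decide)
    · let g : Unit ⊕ Fin 4 → V := f
      have hne : ∀ i j : Fin 4, i ≠ j → g (.inr i) ≠ g (.inr j) := fun i j h e =>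
        h (Sum.inr_injective (f.injective e))
      have hhub : ∀ i : Fin 4, Edge c r (g (.inl ())) (g (.inr i)) := fun i => by
        rw [← hE]
        exact f.toHom.map_adj (show (wheelGraph 5).Adj (.inl ()) (.inr i) by
          simp [wheelGraph, completeBipartiteGraph])
      have hrim : ∀ i j : Fin 4, (SimpleGraph.cycleGraph 4).Adj i j →
          Edge c r (g (.inr i)) (g (.inr j)) := fun i j h => by
        rw [← hE]
        exact f.toHom.map_adj (show (wheelGraph 5).Adj (.inr i) (.inr j) from .inl h)
      exact hc.wheel r _ (g (.inr 0)) (g (.inr 1)) (g (.inr 2)) (g (.inr 3))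
        (hne _ _ (by decide)) (hne _ _ (by decide)) (hhub 0) (hhub 1) (hhub 2) (hhub 3)
        (hrim _ _ (by decide)) (hrim _ _ (by decide)) (hrim _ _ (by decide))
        (hrim _ _ (by decide))
  · intro hc
    by_contra! h
    refine hc ⟨⟨hsymm, fun x y z hxy hyz hxz => ?_⟩, ?_⟩
    · by_contra! ⟨h1, h2, h3⟩
      have hinj : Function.Injective ![x, y, z] := by
        intro i j hij
        fin_cases i <;> fin_cases j <;> simp_all
      refine h.1 ⟨⟨⟨![x, y, z], fun {i j} hij => hinj.ne hij⟩, hinj⟩, ?_⟩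
      rintro ⟨⟨i, j⟩, hij⟩ ⟨⟨k, l⟩, hkl⟩ he
      refine Subtype.ext (sym2_eq_of_colour_eq (fun i j => hsymm (![x, y, z] i) (![x, y, z] j))
        h1 h2 h3 hij hkl ?_)
      exact (hC _ _ (hinj.ne hij)).symm.trans (he.trans (hC _ _ (hinj.ne hkl)))
    · intro r v p q s u hps hqu h1 h2 h3 h4 h5 h6 h7 h8
      have hinj := injective_wheel h1.1 h2.1 h3.1 h4.1 h5.1 hps h8.1.symm h6.1 hqu h7.1
      refine h.2 ⟨r, ⟨⟨⟨Sum.elim (fun _ => v) ![p, q, s, u], fun {i j} hij => ?_⟩, hinj⟩⟩⟩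
      rw [hE]
      have hs : ∀ {x y}, Edge c r x y → Edge c r y x := fun {x y} h => ⟨h.1.symm, hsymm y x ▸ h.2⟩
      have hhub : ∀ i : Fin 4, Edge c r v (![p, q, s, u] i) := fun i => by
        fin_cases i <;> assumption
      rcases i with i | i <;> rcases j with j | j
      · simp [wheelGraph, completeBipartiteGraph] at hij
      · exact hhub j
      · exact hs (hhub i)
      · have hadj : (SimpleGraph.cycleGraph 4).Adj i j := by
          rcases hij with h | h
          · exact h
          · simp [completeBipartiteGraph] at h
        change Fin 4 at i j
        have h5' := hs h5
        have h6' := hs h6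
        have h7' := hs h7
        have h8' := hs h8
        revert hadj
        fin_cases i <;> fin_cases j <;> intro hadj <;>
          first
          | assumption
          | exact absurd hadj (by decide)

/-- Colourings of `Fin m` without rainbow triangles and monochromatic `W₅` decide membership in
the set whose least element is the Gallai–Ramsey number. -/
lemma forall_labelling_iff (m k : ℕ) [NeZero k] :
    (∀ C : SimpleGraph.TopEdgeLabeling (Fin m) (Fin k),
      HasRainbowCopy C (⊤ : SimpleGraph (Fin 3)) ∨ HasMonochromaticCopy C (wheelGraph 5)) ↔
      ∀ c : Fin m → Fin m → Fin k, ¬ IsGood c := by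
  constructor
  · intro h c hc
    exact (hasRainbowCopy_or_hasMonochromaticCopy_iff
      (C := SimpleGraph.EdgeLabeling.mk (fun x y _ => c x y) fun x y _ => hc.symm y x)
      (fun _ _ _ => rfl) hc.symm).1 (h _) hc
  · intro h C
    classical
    refine (hasRainbowCopy_or_hasMonochromaticCopy_iff
      (c := fun x y => if h : x ≠ y then C.get x y h else 0)
      (fun x y h => (dif_pos (show x ≠ y from h.ne)).symm) fun x y => ?_).2 (h _)
    by_cases hxy : x = y
    · rw [hxy]
    · rw [dif_pos hxy, dif_pos (Ne.symm hxy), SimpleGraph.EdgeLabeling.get_comm]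

end Labelling

/-! ### The lower bound -/

section LowerBound

variable {V K : Type*} {c : V → V → K}

lemma IsGood.comap {V' K' : Type*} (hc : IsGood c) (g : V' ↪ V) (e : K ↪ K') :
    IsGood fun x y => e (c (g x) (g y)) := by
  have hE : ∀ {r x y}, Edge (fun x y => e (c (g x) (g y))) r x y → ∃ s, e s = r := fun h =>
    ⟨_, h.2⟩
  have hE' : ∀ {s x y}, Edge (fun x y => e (c (g x) (g y))) (e s) x y → Edge c s (g x) (g y) :=
    fun h => ⟨g.injective.ne h.1, e.injective h.2⟩
  refine ⟨⟨fun x y => by rw [hc.symm], fun x y z h1 h2 h3 => ?_⟩, ?_⟩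
  · simp only [e.injective.eq_iff]
    exact hc.triangle _ _ _ (g.injective.ne h1) (g.injective.ne h2) (g.injective.ne h3)
  · intro r v p q s u hps hqu h1 h2 h3 h4 h5 h6 h7 h8
    obtain ⟨r, rfl⟩ := hE h1
    exact hc.wheel r _ _ _ _ _ (g.injective.ne hps) (g.injective.ne hqu) (hE' h1) (hE' h2)
      (hE' h3) (hE' h4) (hE' h5) (hE' h6) (hE' h7) (hE' h8)

lemma IsGood.exists_fin [Fintype V] [Fintype K] (hc : IsGood c) {m k : ℕ}
    (hm : m ≤ Fintype.card V) (hk : Fintype.card K = k) :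
    ∃ c : Fin m → Fin m → Fin k, IsGood c :=
  ⟨_, hc.comap ((Fin.castLEEmb hm).trans (Fintype.equivFin V).symm.toEmbedding)
    (Fintype.equivFinOfCardEq hk).toEmbedding⟩

/-- Replace every vertex of a complete graph on `Q` by a copy of `V` that is coloured by `c`. If
the colouring `d` of `Q`, by new colours, has neither rainbow nor monochromatic triangles, no
rainbow triangle and no monochromatic `W₅` arises. -/
lemma IsGood.blowUp {Q L : Type*} [DecidableEq Q] (hc : IsGood c) {d : Q → Q → L}
    (hd : IsGallai d) (hd' : ∀ x y z, x ≠ y → y ≠ z → x ≠ z → d x y = d y z → d x y ≠ d x z) :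
    IsGood fun x y : V × Q =>
      if x.2 = y.2 then (Sum.inl (c x.1 y.1) : K ⊕ L) else Sum.inr (d x.2 y.2) := by
  set c' : V × Q → V × Q → K ⊕ L := fun x y =>
    if x.2 = y.2 then (Sum.inl (c x.1 y.1) : K ⊕ L) else Sum.inr (d x.2 y.2) with hc'
  have hl : ∀ {r x y}, Edge c' (Sum.inl r) x y → x.2 = y.2 ∧ Edge c r x.1 y.1 := by
    rintro r x y ⟨hne, h⟩
    by_cases hxy : x.2 = y.2
    · simp only [hc', hxy, if_true, Sum.inl.injEq] at h
      exact ⟨hxy, fun e => hne (Prod.ext e hxy), h⟩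
    · simp [hc', hxy] at h
  have hr : ∀ {r x y}, Edge c' (Sum.inr r) x y → x.2 ≠ y.2 ∧ d x.2 y.2 = r := by
    rintro r x y ⟨hne, h⟩
    by_cases hxy : x.2 = y.2
    · simp [hc', hxy] at h
    · simp only [hc', hxy, if_false, Sum.inr.injEq] at h
      exact ⟨hxy, h⟩
  refine ⟨⟨fun x y => ?_, fun x y z hxy hyz hxz => ?_⟩, ?_⟩
  · simp only [hc', eq_comm (a := x.2), hc.symm x.1, hd.symm x.2]
  · by_cases h1 : x.2 = y.2 <;> by_cases h2 : y.2 = z.2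
    · have h3 := h1.trans h2
      simp only [hc', h1, h2, if_true, Sum.inl.injEq]
      exact hc.triangle _ _ _ (fun e => hxy (Prod.ext e h1)) (fun e => hyz (Prod.ext e h2))
        fun e => hxz (Prod.ext e h3)
    · simp [hc', h1, h2]
    · simp [hc', h2 ▸ h1, h2]
    · by_cases h3 : x.2 = z.2
      · have h4 : ¬ z.2 = y.2 := fun e => h2 e.symm
        simp [hc', h2, h3, h4, hd.symm z.2]
      · simp only [hc', h1, h2, h3, if_false, Sum.inr.injEq]
        exact hd.triangle _ _ _ h1 h2 h3
  · rintro (r | r) v p q s u hps hqu h1 h2 h3 h4 h5 h6 h7 h8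
    · have e1 := (hl h1).1
      have e2 := (hl h2).1
      have e3 := (hl h3).1
      have e4 := (hl h4).1
      exact hc.wheel r _ _ _ _ _ (fun e => hps (Prod.ext e (e1.symm.trans e3)))
        (fun e => hqu (Prod.ext e (e2.symm.trans e4))) (hl h1).2 (hl h2).2 (hl h3).2 (hl h4).2
        (hl h5).2 (hl h6).2 (hl h7).2 (hl h8).2
    · exact hd' v.2 p.2 q.2 (hr h1).1 (hr h5).1 (hr h2).1 ((hr h1).2.trans (hr h5).2.symm)
        ((hr h1).2.trans (hr h2).2.symm)

/-- On four vertices a single colour is enough. -/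
lemma exists_isGood_four : ∃ c : Fin 4 → Fin 4 → Fin 1, IsGood c := by
  refine ⟨fun _ _ => 0, ⟨⟨fun _ _ => rfl, fun _ _ _ _ _ _ => .inl rfl⟩, ?_⟩⟩
  rintro r v p q s u hps hqu ⟨h1, -⟩ ⟨h2, -⟩ ⟨h3, -⟩ ⟨h4, -⟩ ⟨h5, -⟩ ⟨h6, -⟩ ⟨h7, -⟩ ⟨h8, -⟩
  omega

/-- The colouring of the complete graph on `ℤ/14` in which the differences `±1`, `±2`, `±6`, the
set bits of `12614`, have one colour and the remaining ones the other colour. -/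
def circulantColouring (x y : Fin 14) : Bool := Nat.testBit 12614 (x - y).val

lemma isGood_circulantColouring : IsGood circulantColouring := by
  have hsub : ∀ v x y, circulantColouring (x - v) (y - v) = circulantColouring x y :=
    fun v x y => by simp [circulantColouring]
  have hzero : ∀ r p, circulantColouring 0 p = r → p ≠ 0 → ∀ q, circulantColouring 0 q = r →
      q ≠ 0 → p ≠ q → circulantColouring p q = r → ∀ s, circulantColouring 0 s = r → s ≠ 0 →
      q ≠ s → p ≠ s → circulantColouring q s = r → ∀ u, circulantColouring 0 u = r → u ≠ 0 →
      s ≠ u → u ≠ p → q ≠ u → circulantColouring s u = r → circulantColouring u p ≠ r := by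
    decide +kernel
  refine ⟨⟨by decide +kernel, fun x y z _ _ _ => ?_⟩, ?_⟩
  · generalize circulantColouring x y = a, circulantColouring y z = b, circulantColouring x z = d
    revert a b d
    decide
  · rintro r v p q s u hps hqu ⟨h1, h1'⟩ ⟨h2, h2'⟩ ⟨h3, h3'⟩ ⟨h4, h4'⟩ ⟨h5, h5'⟩ ⟨h6, h6'⟩
      ⟨h7, h7'⟩ ⟨h8, h8'⟩
    rw [← hsub v, sub_self] at h1' h2' h3' h4'
    rw [← hsub v] at h5' h6' h7' h8'
    have hne : ∀ {x y}, x ≠ y → x - v ≠ y - v := fun h e => h (sub_left_injective e)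
    have hv : ∀ {x}, v ≠ x → x - v ≠ 0 := fun h e => h (sub_eq_zero.1 e).symm
    exact hzero r (p - v) h1' (hv h1) (q - v) h2' (hv h2) (hne h5) h5' (s - v) h3' (hv h3)
      (hne h6) (hne hps) h6' (u - v) h4' (hv h4) (hne h7) (hne h8) (hne hqu) h7' h8'

lemma exists_isGood_even (j : ℕ) :
    ∃ c : Fin (14 * 5 ^ j) → Fin (14 * 5 ^ j) → Fin (2 * j + 2), IsGood c := by
  induction j with
  | zero => exact isGood_circulantColouring.exists_fin (by simp) (by simp)
  | succ j ih =>
    obtain ⟨c, hc⟩ := ih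
    -- Colour the edges of a five-cycle and of its complement differently.
    let d : Fin 5 → Fin 5 → Bool := fun x y => x - y = 1 ∨ y - x = 1
    refine (hc.blowUp (d := d) ⟨by decide, by decide⟩ (by decide)).exists_fin ?_ ?_
    · simp [pow_succ, mul_assoc]
    · simp
      omega

lemma exists_isGood_odd (j : ℕ) :
    ∃ c : Fin (28 * 5 ^ j) → Fin (28 * 5 ^ j) → Fin (2 * j + 3), IsGood c := by
  obtain ⟨c, hc⟩ := exists_isGood_even j
  refine (hc.blowUp (d := fun _ _ : Bool => ()) ⟨by decide, by decide⟩ (by decide)).exists_fin ?_ ?_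
  · simp
    omega
  · simp

end LowerBound

lemma wheelBound_even (j : ℕ) : wheelBound (2 * j + 2) 0 = 14 * 5 ^ j := by
  induction j with
  | zero => simp [wheelBound]
  | succ j ih => rw [show 2 * (j + 1) + 2 = 2 * j + 4 by ring, wheelBound, ih]; ring

lemma wheelBound_odd (j : ℕ) : wheelBound (2 * j + 3) 0 = 28 * 5 ^ j := by
  induction j with
  | zero => simp [wheelBound]
  | succ j ih =>
    rw [show 2 * (j + 1) + 3 = (2 * j + 1) + 4 by ring, wheelBound,
      show 2 * j + 1 + 2 = 2 * j + 3 by ring, ih]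
    ring

/-- The upper bound always holds; the number is attained once a colouring of the extremal size
exists. -/
lemma isGallaiRamseyNumber_of_exists {k n : ℕ} [NeZero k] (hn : wheelBound k 0 = n)
    (h : ∃ c : Fin n → Fin n → Fin k, IsGood c) :
    IsGallaiRamseyNumber k (⊤ : SimpleGraph (Fin 3)) (wheelGraph 5) (n + 1) := by
  constructor
  · refine (forall_labelling_iff (n + 1) k).2 fun c hc => ?_
    have := hc.card_le
    simp only [Fintype.card_fin] at this
    omega
  · intro m hm
    by_contra! hlt
    obtain ⟨c, hc⟩ := h
    obtain ⟨c', hc'⟩ := hc.exists_fin (m := m) (by simp; omega) (Fintype.card_fin k)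
    exact (forall_labelling_iff m k).1 hm c' hc'

theorem theorem1p6 (k : ℕ) (hk : 1 ≤ k) :
    (k = 1 → IsGallaiRamseyNumber k (⊤ : SimpleGraph (Fin 3)) (wheelGraph 5) 5) ∧
    (Even k → IsGallaiRamseyNumber k (⊤ : SimpleGraph (Fin 3)) (wheelGraph 5)
      (14 * 5 ^ ((k - 2) / 2) + 1)) ∧
    (3 ≤ k → Odd k → IsGallaiRamseyNumber k (⊤ : SimpleGraph (Fin 3)) (wheelGraph 5)
      (28 * 5 ^ ((k - 3) / 2) + 1)) := by
  refine ⟨?_, ?_, ?_⟩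
  · rintro rfl
    exact isGallaiRamseyNumber_of_exists (by simp [wheelBound]) exists_isGood_four
  · rintro ⟨j, hj⟩
    obtain ⟨j, rfl⟩ : ∃ i, j = i + 1 := ⟨j - 1, by omega⟩
    obtain rfl : k = 2 * j + 2 := by omega
    rw [show (2 * j + 2 - 2) / 2 = j by omega]
    exact isGallaiRamseyNumber_of_exists (wheelBound_even j) (exists_isGood_even j)
  · rintro h3 ⟨j, hj⟩
    obtain ⟨j, rfl⟩ : ∃ i, j = i + 1 := ⟨j - 1, by omega⟩
    obtain rfl : k = 2 * j + 3 := by omega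
    rw [show (2 * j + 3 - 3) / 2 = j by omega]
    exact isGallaiRamseyNumber_of_exists (wheelBound_odd j) (exists_isGood_odd j)
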